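/- **Conventions.** Let $R\subseteq\{0,1\}^*\times\{0,1\}^*$ be a binary relation. $R$ is *polynomially decidable* if a deterministic polynomial-time Turing machine decides $\{(x,y) : (x,y)\in R\}$, and *polynomially balanced* if there is a polynomial $q$ such that $(x,y)\in R$ implies $|y|\le q(|x|)$. $R$ is in $\mathrm{TFUP}$ if it is polynomially decidable, polynomially balanced, and for every $x\in\{0,1\}^*$ there is exactly one $y$ with $(x,y)\in R$. A *deterministic NCCirc algorithm* $\mathcal A$ is a deterministic polynomial-time algorithm that on input $x\in\{0,1\}^*$ outputs a Boolean circuit $\mathcal C_x$ over AND, OR and NOT with the same number $n_x$ of input and output wires, such that for every $x$ the induced function $c_x:\{0,1\}^{n_x}\to\{0,1\}^{n_x}$ has exactly one fixed point $w_x$. For a bit string $w$ let $\mathrm{unpad}(w)$ be obtained by removing all trailing zeros and then the last bit (a $1$) if there is one; thus $\mathrm{unpad}(y10^k)=y$ and $\mathrm{unpad}(0^k)$ is the empty string. The algorithm $\mathcal A$ *decides* $R$ if $R=\{(x,\mathrm{unpad}(w_x)) : x\in\{0,1\}^*\}$, and it *decides $R$ without padding* if $R=\{(x,w_x) : x\in\{0,1\}^*\}$.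 Let $\mathrm{FP}_{\mathrm{NCCirc}}$ be the class of binary relations decided by some deterministic NCCirc algorithm. **Theorem 3.** $\mathrm{FP}_{\mathrm{NCCirc}}=\mathrm{TFUP}$. Moreover, a binary relation is decided without padding by some deterministic NCCirc algorithm if and only if it is in $\mathrm{TFUP}$ and the length of the solution of $x$ is computable (in unary) from $x$ in polynomial time. -/

import Mathlib

namespace NCCirc

/-! ### Boolean circuits over AND, OR, NOT -/

/-- A gate, given by the numbers of the wires that it reads. -/
inductive Gate where
  | andGate (i j : ℕ)
  | orGate (i j : ℕ)
  | notGate (i : ℕ)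

namespace Gate

/-- All wires read by the gate have a number below `N`. -/
def ReadsBelow (N : ℕ) : Gate → Prop
  | andGate i j => i < N ∧ j < N
  | orGate i j => i < N ∧ j < N
  | notGate i => i < N

/-- The output bit of the gate, given the list of values of the preceding wires. -/
def eval (v : List Bool) : Gate → Bool
  | andGate i j => v.getD i false && v.getD j false
  | orGate i j => v.getD i false || v.getD j false
  | notGate i => !(v.getD i false)

end Gate

/-- A Boolean circuit with the same number `width` of input wires and of output wires.
The wires are numbered `0, 1, 2, …`: first the `width` input wires, then the wire leaving each
gate, in the order of the list `gates`. A gate reads only wires with smaller numbers than its own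
(so the circuit is acyclic), and `outputs` lists the wires that leave the circuit, in order.
No wire that a gate or an output refers to is missing, so the default value in `List.getD` is
never used. -/
structure Circuit where
  width : ℕ
  gates : List Gate
  outputs : List ℕ
  outputs_length : outputs.length = width
  gates_wf : ∀ (k : ℕ) (hk : k < gates.length), gates[k].ReadsBelow (width + k)
  outputs_wf : ∀ i ∈ outputs, i < width + gates.length

/-- The alphabet in which circuits are written down. -/
inductive Symbol where
  | tick
  | sep
  | andSym
  | orSym
  | notSym

/-- A wire number in unary, followed by an end mark. -/
def encodeNat (n : ℕ) : List Symbol :=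
  List.replicate n Symbol.tick ++ [Symbol.sep]

/-- The string describing a gate. -/
def Gate.encode : Gate → List Symbol
  | Gate.andGate i j => Symbol.andSym :: (encodeNat i ++ encodeNat j)
  | Gate.orGate i j => Symbol.orSym :: (encodeNat i ++ encodeNat j)
  | Gate.notGate i => Symbol.notSym :: encodeNat i

namespace Circuit

/-- The string describing a circuit: its width, its gates, its outputs. Every wire is an input
(so it has its own output in the description) or is produced by a gate of the description; hence
writing wire numbers in unary changes lengths only polynomially. -/
def encode (C : Circuit) : List Symbol :=
  encodeNat C.width ++ (C.gates.flatMap Gate.encode ++ C.outputs.flatMap encodeNat)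

/-- The values of all wires on the input `y`. -/
def wires (C : Circuit) (y : List Bool) : List Bool :=
  C.gates.foldl (fun v g => v ++ [g.eval v]) y

/-- The function `{0,1}ⁿ → {0,1}ⁿ` induced by a circuit with `n` input and `n` output wires. -/
def fn (C : Circuit) (y : List.Vector Bool C.width) : List.Vector Bool C.width :=
  ⟨C.outputs.map (fun i => (C.wires y.toList).getD i false), by
    rw [List.length_map, C.outputs_length]⟩

/-- The closed circuit obtained by connecting each output wire with the input wire of the same
label is logically consistent: the induced function has a unique fixed point. -/
def LogicallyConsistent (C : Circuit) : Prop :=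
  ∃! y : List.Vector Bool C.width, Function.IsFixedPt C.fn y

end Circuit

/-! ### Polynomial time -/

/-- `f` is computed by a deterministic Turing machine in time polynomial in the length of the
input, where inputs and outputs are written as strings by `ea` and `eb`. -/
def PolyTime {α β A B : Type} (ea : α → List A) (eb : β → List B) (f : α → β) : Prop :=
  Nonempty (Turing.TM2ComputableInPolyTime ea eb f)

/-- A pair of bit strings as one string, with a separator. -/
def encodePair (p : List Bool × List Bool) : List (Option Bool) :=
  p.1.map some ++ none :: p.2.map some

/-- Natural numbers in unary. -/
def encodeUnary (n : ℕ) : List Bool := List.replicate n true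

/-! ### Binary relations on bit strings and the class TFUP -/

open Classical in
/-- Membership in `R` is decided by a deterministic polynomial-time Turing machine. -/
def PolynomiallyDecidable (R : Set (List Bool × List Bool)) : Prop :=
  PolyTime encodePair Computability.encodeBool (fun p => decide (p ∈ R))

/-- Solutions are polynomially bounded in length. -/
def PolynomiallyBalanced (R : Set (List Bool × List Bool)) : Prop :=
  ∃ q : Polynomial ℕ, ∀ x y : List Bool, (x, y) ∈ R → y.length ≤ q.eval x.length

/-- Total search problems with unique solutions. -/
def TFUP : Set (Set (List Bool × List Bool)) :=
  {R | PolynomiallyDecidable R ∧ PolynomiallyBalanced R ∧ ∀ x : List Bool, ∃! y, (x, y) ∈ R}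

/-- The length of the solutions can be computed (in unary) in polynomial time. -/
def PolyTimeSolutionLength (R : Set (List Bool × List Bool)) : Prop :=
  ∃ l : List Bool → ℕ, PolyTime (fun x : List Bool => x) encodeUnary l ∧
    ∀ x y : List Bool, (x, y) ∈ R → y.length = l x

/-! ### Deterministic NCCirc algorithms -/

/-- A deterministic NCCirc algorithm: in polynomial time it maps every bit string `x` to
a circuit whose closed circuit is logically consistent. -/
structure Algorithm where
  circuit : List Bool → Circuit
  polyTime : PolyTime (fun x : List Bool => x) Circuit.encode circuit
  consistent : ∀ x, (circuit x).LogicallyConsistent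

/-- Remove the padding from a string: `y 1 0 … 0` becomes `y` (and `0 … 0` becomes empty). -/
def unpad (w : List Bool) : List Bool :=
  (w.rdropWhile (fun b => !b)).dropLast

namespace Algorithm

/-- The algorithm decides `R`, the solution for `x` being the fixed point of the circuit for `x`
with its padding removed. -/
def Decides (𝒜 : Algorithm) (R : Set (List Bool × List Bool)) : Prop :=
  ∀ x y : List Bool, (x, y) ∈ R ↔
    ∃ w : List.Vector Bool (𝒜.circuit x).width,
      Function.IsFixedPt (𝒜.circuit x).fn w ∧ unpad w.toList = y

/-- The algorithm decides `R`, the solution for `x` being the fixed point itself of the circuit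
for `x`. -/
def DecidesExactly (𝒜 : Algorithm) (R : Set (List Bool × List Bool)) : Prop :=
  ∀ x y : List Bool, (x, y) ∈ R ↔
    ∃ w : List.Vector Bool (𝒜.circuit x).width,
      Function.IsFixedPt (𝒜.circuit x).fn w ∧ w.toList = y

end Algorithm

/-- The binary relations decided by deterministic NCCirc algorithms, where solutions are padded
to the number of wires of the circuit. -/
def FPNCCirc : Set (Set (List Bool × List Bool)) :=
  {R | ∃ 𝒜 : Algorithm, 𝒜.Decides R}

/-- The binary relations decided by deterministic NCCirc algorithms, where solutions must fill all
the wires of the circuit, without padding. -/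
def FPNCCircExact : Set (Set (List Bool × List Bool)) :=
  {R | ∃ 𝒜 : Algorithm, 𝒜.DecidesExactly R}

end NCCirc

/-! A fixed point is easy to check, and a check is easy to turn into fixed points.

Checking: a circuit can be evaluated from its description in polynomial time, so "`w` is mapped to
itself" is a polynomial-time property of `x` and `w` (`poly_checkFixed`, `checkFixed_encode`).
Logical consistency gives exactly one solution, and the width, which stands at the head of the
description, is its length.

Turning a check into fixed points: let a machine decide `R` and let solutions of `x` have length `n
> 0`. A tableau argument in the style of Cook and Levin yields a circuit that computes from `w` the
answer of the machine on `(x, w)`. Its first output is `w₀` if the answer is yes and the negation of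
`w₀` if it is no; every other output copies its input. An accepted `w` is thus fixed, and a rejected
one has its first bit flipped. The fixed points are exactly the solutions, and uniqueness of the
solution is logical consistency (`Simulator.Simulates.outputs_eq_iff`, `mem_FPNCCircExact`). The
width has to be known when the circuit is written, which is why the length of the solution must be
computable.

Padding removes this requirement: the solutions `y` are replaced by the strings `y10…0` of a common
length, one more than the polynomial bound on `|y|`. Conversely, a given `y` has at most two strings
of given length that unpad to it, so both can be tested (`mem_FPNCCirc_of_mem_TFUP`,
`mem_TFUP_of_mem_FPNCCirc`).

The rest is machine work. Polynomial time means multi-stack machines, so closure under composition,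
pairing and bounded iteration is proved by assembling programs (`PolyTime.comp`, `PolyTime.pair`,
`PolyTime.iterate`). On this rests a calculus `Poly` in which the evaluation of circuits and the
writing of the tableau circuit are polynomial time by composition. -/

namespace NCCirc

open Turing Turing.TM2 Function

/-! ### Programs for stack machines: sequencing, loops, embedding, growth of stacks -/

section Fragments

variable {K K₁ : Type} [DecidableEq K] [DecidableEq K₁] {Γ : K → Type} {Λ Λ' σ σ₁ : Type}

/-- `Steps m n c c'`: the program `m` leads from `c` to `c'` in exactly `n` steps. -/
inductive Steps (m : Λ → Stmt Γ Λ σ) : ℕ → Cfg Γ Λ σ → Cfg Γ Λ σ → Prop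
  | refl (c) : Steps m 0 c c
  | head {n l v S c'} : Steps m n (stepAux (m l) v S) c' → Steps m (n + 1) ⟨some l, v, S⟩ c'

theorem Steps.trans {m : Λ → Stmt Γ Λ σ} {n n' c c' c''} (h : Steps m n c c')
    (h' : Steps m n' c' c'') : Steps m (n + n') c c'' := by
  induction h with
  | refl => simpa using h'
  | head _ ih => rw [Nat.add_right_comm]; exact .head (ih h')

/-- Connects the inductive relation with the iterated partial step function in which machine
computations are defined. Iteration from `none` stays at `none`, so no step can be counted after
halting. -/
theorem steps_iff {m : Λ → Stmt Γ Λ σ} {n c c'} :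
    Steps m n c c' ↔ (flip bind (step m))^[n] (some c) = some c' := by
  have hnone : ∀ n, (flip bind (step m))^[n] none = none := by
    intro n
    induction n with
    | zero => rfl
    | succ n ih => rw [iterate_succ_apply]; exact ih
  induction n generalizing c with
  | zero =>
    constructor
    · rintro ⟨⟩; rfl
    · intro h; cases h; exact .refl _
  | succ n ih =>
    rw [iterate_succ_apply]
    rcases c with ⟨_ | l, v, S⟩
    · constructor
      · rintro ⟨⟩
      · intro h
        have : flip bind (step m) (some ⟨none, v, S⟩) = none := rfl
        rw [this, hnone] at h
        cases h
    · have : flip bind (step m) (some ⟨some l, v, S⟩) = some (stepAux (m l) v S) := rfl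
      rw [this]
      exact Iff.trans ⟨fun h => by cases h; assumption, .head⟩ ih

/-- Rename the labels of a statement, and leave it through `e` where it halts. -/
def relabel (f : Λ → Λ') (e : Option Λ') : Stmt Γ Λ σ → Stmt Γ Λ' σ
  | .push k g q => .push k g (relabel f e q)
  | .peek k g q => .peek k g (relabel f e q)
  | .pop k g q => .pop k g (relabel f e q)
  | .load g q => .load g (relabel f e q)
  | .branch g q₁ q₂ => .branch g (relabel f e q₁) (relabel f e q₂)
  | .goto g => .goto (f ∘ g)
  | .halt => e.elim .halt fun l => .goto fun _ => l

/-- Rename the label of a configuration, a halting one continuing with `e`. -/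
def relabelCfg (f : Λ → Λ') (e : Option Λ') (c : Cfg Γ Λ σ) : Cfg Γ Λ' σ :=
  ⟨(c.l.map f).or e, c.var, c.stk⟩

theorem stepAux_relabel (f : Λ → Λ') (e : Option Λ') (q : Stmt Γ Λ σ) (v : σ)
    (S : ∀ k, List (Γ k)) :
    stepAux (relabel f e q) v S = relabelCfg f e (stepAux q v S) := by
  induction q generalizing v S with
  | push _ _ _ ih | peek _ _ _ ih | pop _ _ _ ih | load _ _ ih => exact ih _ _
  | branch g _ _ ih₁ ih₂ =>
    simp only [relabel, stepAux]
    cases g v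
    exacts [ih₂ _ _, ih₁ _ _]
  | goto => rfl
  | halt => cases e <;> rfl

theorem Steps.relabel {m : Λ → Stmt Γ Λ σ} {m' : Λ' → Stmt Γ Λ' σ} {f : Λ → Λ'} {e : Option Λ'}
    (hm : ∀ l, m' (f l) = relabel f e (m l)) {n c c'} (h : Steps m n c c') :
    Steps m' n (relabelCfg f e c) (relabelCfg f e c') := by
  induction h with
  | refl => exact .refl _
  | head _ ih => exact .head (by rwa [hm, stepAux_relabel])

variable (Γ σ) in
/-- The internal state together with the stacks. -/
abbrev Store := σ × ∀ k, List (Γ k)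

variable (Γ σ) in
/-- A program fragment, left by halting. -/
structure Frag where
  /-- labels -/
  Λ : Type
  [fin : Fintype Λ]
  /-- entry -/
  main : Λ
  /-- code -/
  m : Λ → Stmt Γ Λ σ

attribute [instance] Frag.fin

namespace Frag

/-- The fragment, entered with store `s`, is left with store `s'` after at most `t` steps. -/
def Runs (P : Frag Γ σ) (t : ℕ) (s s' : Store Γ σ) : Prop :=
  ∃ n ≤ t, Steps P.m n ⟨some P.main, s.1, s.2⟩ ⟨none, s'.1, s'.2⟩

theorem Runs.mono {P : Frag Γ σ} {t t' s s'} (h : P.Runs t s s') (ht : t ≤ t') : P.Runs t' s s' :=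
  h.imp fun _ h => ⟨h.1.trans ht, h.2⟩

/-- Run `P`, then `Q`. -/
def seq (P Q : Frag Γ σ) : Frag Γ σ where
  Λ := P.Λ ⊕ Q.Λ
  main := .inl P.main
  m := Sum.elim (fun l => relabel .inl (some (.inr Q.main)) (P.m l))
    (fun l => relabel .inr none (Q.m l))

/-- Replacing `halt` by a jump costs nothing: the jump ends the same step that would have halted.
Hence the times simply add. -/
theorem Runs.seq {P Q : Frag Γ σ} {t t' s s' s''} (h : P.Runs t s s') (h' : Q.Runs t' s' s'') :
    (P.seq Q).Runs (t + t') s s'' := by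
  obtain ⟨n, hn, h⟩ := h
  obtain ⟨n', hn', h'⟩ := h'
  refine ⟨n + n', add_le_add hn hn', ?_⟩
  exact (h.relabel (m' := (P.seq Q).m) (f := .inl) (e := some (.inr Q.main)) fun _ => rfl).trans
    (h'.relabel (m' := (P.seq Q).m) (f := .inr) (e := none) fun _ => rfl)

/-- Pop from stack `k`; if the condition `c` holds then, reset the state, run `P` and repeat. -/
def loop (k : K) (upd : σ → Option (Γ k) → σ) (c : σ → Bool) (reset : σ → σ) (P : Frag Γ σ) :
    Frag Γ σ where
  Λ := Unit ⊕ P.Λ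
  main := .inl ()
  m := Sum.elim
    (fun _ => .pop k upd (.branch c (.load reset (.goto fun _ => .inr P.main)) .halt))
    (fun l => relabel .inr (some (.inl ())) (P.m l))

/-- Here `s i` is the store before pass `i`. Each pass costs one step for the pop and the test
besides the body, and the failing test at the end costs one more. -/
theorem Runs.loop {k : K} {upd : σ → Option (Γ k) → σ} {c : σ → Bool} {reset : σ → σ}
    {P : Frag Γ σ} {t n : ℕ} (s : ℕ → Store Γ σ)
    (hc : ∀ i < n, c (upd (s i).1 ((s i).2 k).head?) = true)
    (hP : ∀ i < n, P.Runs t (reset (upd (s i).1 ((s i).2 k).head?),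
      update (s i).2 k ((s i).2 k).tail) (s (i + 1)))
    (hn : c (upd (s n).1 ((s n).2 k).head?) = false) :
    (loop k upd c reset P).Runs (n * (t + 1) + 1) (s 0)
      (upd (s n).1 ((s n).2 k).head?, update (s n).2 k ((s n).2 k).tail) := by
  induction n generalizing s with
  | zero =>
    refine ⟨1, by simp, .head (n := 0) ?_⟩
    have := Steps.refl (m := (Frag.loop k upd c reset P).m)
      ⟨none, upd (s 0).1 ((s 0).2 k).head?, update (s 0).2 k ((s 0).2 k).tail⟩
    simpa [Frag.loop, hn] using this
  | succ n ih =>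
    obtain ⟨n', hn', h⟩ := ih (fun i => s (i + 1)) (fun i hi => hc _ (by omega))
      (fun i hi => hP _ (by omega)) hn
    obtain ⟨n₁, hn₁, h₁⟩ := hP 0 (by omega)
    have h₂ := h₁.relabel (m' := (Frag.loop k upd c reset P).m) (f := .inr)
      (e := some (.inl ())) (fun _ => rfl)
    refine ⟨(n₁ + n') + 1, ?_, .head ?_⟩
    · rw [add_mul]; omega
    · refine Steps.trans ?_ h
      simp only [Frag.loop, Sum.elim_inl, stepAux, hc 0 (by omega), cond_true]
      exact h₂

end Frag

/-- A statement for some of the stacks and a part of the state, acting on all. -/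
def embedStmt (e : K₁ → K) (get : σ → σ₁) (set : σ → σ₁ → σ) :
    Stmt (fun k => Γ (e k)) Λ σ₁ → Stmt Γ Λ σ
  | .push k g q => .push (e k) (fun s => g (get s)) (embedStmt e get set q)
  | .peek k g q => .peek (e k) (fun s o => set s (g (get s) o)) (embedStmt e get set q)
  | .pop k g q => .pop (e k) (fun s o => set s (g (get s) o)) (embedStmt e get set q)
  | .load g q => .load (fun s => set s (g (get s))) (embedStmt e get set q)
  | .branch g q₁ q₂ =>
    .branch (fun s => g (get s)) (embedStmt e get set q₁) (embedStmt e get set q₂)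
  | .goto g => .goto fun s => g (get s)
  | .halt => .halt

/-- `get` and `set` access a part of a state. -/
structure IsLens (get : σ → σ₁) (set : σ → σ₁ → σ) : Prop where
  get_set : ∀ s v, get (set s v) = v
  set_set : ∀ s v v', set (set s v) v' = set s v'
  set_get : ∀ s, set s (get s) = s

/-- Injectivity of `e` makes an update of stack `e k` look like an update of stack `k` alone from
inside; the lens laws do the same for the state. Stacks outside the range of `e` are never touched,
which allows several machines to live side by side. -/
theorem stepAux_embedStmt {e : K₁ → K} (he : Injective e) {get : σ → σ₁} {set : σ → σ₁ → σ}
    (hl : IsLens get set) (q : Stmt (fun k => Γ (e k)) Λ σ₁) (s : σ) (v : σ₁)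
    (S : ∀ k, List (Γ k)) :
    ∃ S', stepAux (embedStmt e get set q) (set s v) S =
        ⟨(stepAux q v fun k => S (e k)).l, set s (stepAux q v fun k => S (e k)).var, S'⟩ ∧
      (fun k => S' (e k)) = (stepAux q v fun k => S (e k)).stk ∧
      ∀ k, (∀ k', e k' ≠ k) → S' k = S k := by
  induction q generalizing v S with
  | push k g q ih =>
    obtain ⟨S', h₁, h₂, h₃⟩ := ih v (update S (e k) (g v :: S (e k)))
    rw [update_comp_eq_of_injective' (β := fun k => List (Γ k)) S he] at h₁ h₂
    refine ⟨S', by simpa [embedStmt, hl.get_set] using h₁, h₂, fun k' hk' => ?_⟩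
    rw [h₃ _ hk', update_of_ne (hk' k).symm]
  | peek k g q ih =>
    obtain ⟨S', h₁, h₂, h₃⟩ := ih (g v (S (e k)).head?) S
    exact ⟨S', by simpa [embedStmt, hl.get_set, hl.set_set] using h₁, h₂, h₃⟩
  | pop k g q ih =>
    obtain ⟨S', h₁, h₂, h₃⟩ := ih (g v (S (e k)).head?) (update S (e k) (S (e k)).tail)
    rw [update_comp_eq_of_injective' (β := fun k => List (Γ k)) S he] at h₁ h₂
    refine ⟨S', by simpa [embedStmt, hl.get_set, hl.set_set] using h₁, h₂, fun k' hk' => ?_⟩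
    rw [h₃ _ hk', update_of_ne (hk' k).symm]
  | load g q ih =>
    obtain ⟨S', h₁, h₂, h₃⟩ := ih (g v) S
    exact ⟨S', by simpa [embedStmt, hl.get_set, hl.set_set] using h₁, h₂, h₃⟩
  | branch g q₁ q₂ ih₁ ih₂ =>
    simp only [embedStmt, stepAux, hl.get_set]
    cases g v
    exacts [ih₂ v S, ih₁ v S]
  | goto g => exact ⟨S, by simp [embedStmt, hl.get_set], rfl, fun _ _ => rfl⟩
  | halt => exact ⟨S, by simp [embedStmt], rfl, fun _ _ => rfl⟩

theorem Steps.embed {e : K₁ → K} (he : Injective e) {get : σ → σ₁} {set : σ → σ₁ → σ}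
    (hl : IsLens get set) {m : Λ → Stmt (fun k => Γ (e k)) Λ σ₁} {n c c'} (h : Steps m n c c')
    (s : σ) (S : ∀ k, List (Γ k)) (hS : (fun k => S (e k)) = c.stk) :
    ∃ S', Steps (fun l => embedStmt e get set (m l)) n ⟨c.l, set s c.var, S⟩
        ⟨c'.l, set s c'.var, S'⟩ ∧
      (fun k => S' (e k)) = c'.stk ∧ ∀ k, (∀ k', e k' ≠ k) → S' k = S k := by
  induction h generalizing S with
  | refl c => exact ⟨S, .refl _, hS, fun _ _ => rfl⟩
  | @head n l v S₀ c' _ ih =>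
    obtain ⟨S₁, h₁, h₂, h₃⟩ := stepAux_embedStmt he hl (m l) s v S
    subst hS
    obtain ⟨S', hsteps, h₂', h₃'⟩ := ih S₁ h₂
    refine ⟨S', .head ?_, h₂', fun k hk => (h₃' k hk).trans (h₃ k hk)⟩
    rw [h₁]
    exact hsteps

/-- All stacks empty but one. -/
def single (k₀ : K) (l : List (Γ k₀)) : ∀ k, List (Γ k) := update (fun _ => []) k₀ l

@[simp] theorem single_self (k₀ : K) (l : List (Γ k₀)) : single k₀ l k₀ = l := update_self ..

@[simp] theorem update_single (k₀ : K) (l l' : List (Γ k₀)) :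
    update (single k₀ l) k₀ l' = single k₀ l' := update_idem ..

theorem single_nil (k₀ : K) : single (Γ := Γ) k₀ [] = fun _ => [] := update_eq_self k₀ (fun _ => [])

theorem initList_stk (tm : FinTM2) (s) : (initList tm s).stk = single tm.k₀ s := by
  funext k
  by_cases h : k = tm.k₀
  · subst h; simp [initList]
  · simp [initList, h, single]

theorem haltList_stk (tm : FinTM2) (s) : (haltList tm s).stk = single tm.k₁ s := by
  funext k
  by_cases h : k = tm.k₁
  · subst h; simp [haltList]
  · simp [haltList, h, single]

theorem initList_eq (tm : FinTM2) (s) :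
    initList tm s = ⟨some tm.main, tm.initialState, single tm.k₀ s⟩ := by
  rw [← initList_stk]; rfl

theorem haltList_eq (tm : FinTM2) (s) :
    haltList tm s = ⟨none, tm.initialState, single tm.k₁ s⟩ := by
  rw [← haltList_stk]; rfl

variable {α β A B : Type} {ea : α → List A} {eb : β → List B} {f : α → β}

/-- The final store is fully prescribed: the state is again the initial one, and all stacks but the
output stack are empty. Fragments therefore have to clean up after themselves, and in return
finished machines can be run again. -/
theorem PolyTime.of_frag [Fintype K] [Fintype σ] (P : Frag Γ σ) (v₀ : σ) (k₀ k₁ : K)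
    [Fintype (Γ k₀)] (iA : Γ k₀ ≃ A) (iB : Γ k₁ ≃ B) (p : Polynomial ℕ)
    (h : ∀ a, P.Runs (p.eval (ea a).length) (v₀, single k₀ ((ea a).map iA.symm))
      (v₀, single k₁ ((eb (f a)).map iB.symm))) : PolyTime ea eb f := by
  let tm : FinTM2 :=
    { K := K, k₀ := k₀, k₁ := k₁, Γ := Γ, Λ := P.Λ, main := P.main, σ := σ
      initialState := v₀, m := P.m }
  refine ⟨{ tm := tm, inputAlphabet := iA, outputAlphabet := iB, time := p
            outputsFun := fun a => ?_ }⟩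
  have := h a
  refine ⟨⟨this.choose, ?_⟩, this.choose_spec.1⟩
  rw [Option.map_some, initList_eq, haltList_eq]
  exact steps_iff.1 this.choose_spec.2

/-- The machine of a polynomial time function, in terms of `Steps`. -/
theorem PolyTime.exists_steps (h : PolyTime ea eb f) :
    ∃ (tm : FinTM2) (iA : tm.Γ tm.k₀ ≃ A) (iB : tm.Γ tm.k₁ ≃ B) (p : Polynomial ℕ), ∀ a,
      ∃ n ≤ p.eval (ea a).length,
        Steps tm.m n ⟨some tm.main, tm.initialState, single tm.k₀ ((ea a).map iA.symm)⟩
          ⟨none, tm.initialState, single tm.k₁ ((eb (f a)).map iB.symm)⟩ := by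
  obtain ⟨M⟩ := h
  refine ⟨M.tm, M.inputAlphabet, M.outputAlphabet, M.time, fun a => ?_⟩
  obtain ⟨⟨n, h⟩, hn⟩ := M.outputsFun a
  refine ⟨n, hn, steps_iff.2 ?_⟩
  rw [Option.map_some, initList_eq, haltList_eq] at h
  exact h

/-- The number of instructions of a statement. -/
def stmtSize : Stmt Γ Λ σ → ℕ
  | .push _ _ q | .peek _ _ q | .pop _ _ q | .load _ q => stmtSize q + 1
  | .branch _ q₁ q₂ => stmtSize q₁ + stmtSize q₂ + 1
  | .goto _ | .halt => 1

theorem length_stepAux_le (q : Stmt Γ Λ σ) (v : σ) (S : ∀ k, List (Γ k)) (k : K) :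
    ((stepAux q v S).stk k).length ≤ (S k).length + stmtSize q := by
  induction q generalizing v S with
  | push k' g q ih =>
    refine (ih v _).trans ?_
    by_cases hk : k = k'
    · subst hk; simp [stmtSize]; omega
    · simp [stmtSize, hk]
  | pop k' g q ih =>
    refine (ih _ _).trans ?_
    by_cases hk : k = k'
    · subst hk; simp [stmtSize]; omega
    · simp [stmtSize, hk]
  | peek _ _ q ih | load _ q ih => exact (ih _ _).trans (by simp [stmtSize])
  | branch g q₁ q₂ ih₁ ih₂ =>
    simp only [stepAux]
    cases g v
    · exact (ih₂ _ _).trans (by simp [stmtSize]; omega)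
    · exact (ih₁ _ _).trans (by simp [stmtSize]; omega)
  | goto | halt => simp [stmtSize]

theorem Steps.length_le {m : Λ → Stmt Γ Λ σ} {C : ℕ} (hC : ∀ l, stmtSize (m l) ≤ C) {n c c'}
    (h : Steps m n c c') (k : K) : (c'.stk k).length ≤ (c.stk k).length + n * C := by
  induction h with
  | refl => simp
  | @head n l v S c' _ ih =>
    have := length_stepAux_le (m l) v S k
    have := hC l
    simp only at ih ⊢
    rw [add_mul]; omega

/-- One step pushes at most as many symbols as its statement has instructions, and there are
finitely many statements. So the output is longer than the input by at most a constant times the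
running time. This bounds the time of a machine that reads the output of another. -/
theorem PolyTime.length_le (h : PolyTime ea eb f) :
    ∃ p : Polynomial ℕ, ∀ a, (eb (f a)).length ≤ p.eval (ea a).length := by
  obtain ⟨tm, iA, iB, p, h⟩ := h.exists_steps
  have := tm.ΛFin
  obtain ⟨C, hC⟩ := (Set.finite_range fun l => stmtSize (tm.m l)).bddAbove
  refine ⟨.X + p * .C C, fun a => ?_⟩
  obtain ⟨n, hn, h⟩ := h a
  have h₁ := h.length_le (fun l => hC ⟨l, rfl⟩) tm.k₁
  have h₂ : (single (Γ := tm.Γ) tm.k₀ ((ea a).map iA.symm) tm.k₁).length ≤ (ea a).length := by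
    by_cases hk : tm.k₁ = tm.k₀
    · rw [hk]; simp
    · simp [single, hk]
  simp only [single_self, List.length_map] at h₁
  simp only [Polynomial.eval_add, Polynomial.eval_X, Polynomial.eval_mul, Polynomial.eval_C]
  have := Nat.mul_le_mul_right C hn
  omega

theorem eval_mono (p : Polynomial ℕ) {m n : ℕ} (h : m ≤ n) : p.eval m ≤ p.eval n := by
  induction p using Polynomial.induction_on' with
  | add p q hp hq => simpa using add_le_add hp hq
  | monomial k a => simpa using Nat.mul_le_mul_left a (Nat.pow_le_pow_left h k)

end Fragments

end NCCirc

namespace NCCirc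

open Turing Turing.TM2 Function

/-! ### Copying between stacks -/

section Moving

variable {K : Type} [DecidableEq K] {Γ : K → Type} {σ T : Type}

/-- Move the content of stack `a` to stack `b`, reversing it. -/
def moveFrag (a b : K) (i : Γ a → T) (o : T → Γ b) (d : Γ b) : Frag Γ (σ × Option T) where
  Λ := Unit
  main := ()
  m _ := .pop a (fun s x => (s.1, x.map i)) <| .branch (fun s => s.2.isSome)
    (.push b (fun s => s.2.elim d o) <| .goto fun _ => ()) .halt

theorem moveFrag_runs {a b : K} (hab : a ≠ b) (i : Γ a → T) (o : T → Γ b) (d : Γ b)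
    (v : σ) (x : Option T) (S : ∀ k, List (Γ k)) :
    (moveFrag a b i o d).Runs ((S a).length + 1) ((v, x), S)
      ((v, none), update (update S a []) b (((S a).map fun y => o (i y)).reverse ++ S b)) := by
  generalize hl : S a = l
  induction l generalizing x S with
  | nil =>
    refine ⟨1, by simp, .head (n := 0) ?_⟩
    have : update S a [] = S := by rw [← hl, update_eq_self]
    simp only [moveFrag, stepAux, hl, List.head?_nil, Option.map_none, Option.isSome_none,
      cond_false, List.tail_nil, this, List.map_nil, List.reverse_nil, List.nil_append,
      update_eq_self]
    exact .refl _
  | cons y l ih =>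
    obtain ⟨n, hn, h⟩ := ih (some (i y)) (update (update S a l) b (o (i y) :: S b)) (by simp [hab])
    refine ⟨n + 1, by simpa using hn, .head ?_⟩
    have e : update (update (update (update S a l) b (o (i y) :: S b)) a []) b
        ((l.map fun y => o (i y)).reverse ++ update (update S a l) b (o (i y) :: S b) b) =
        update (update S a []) b (((y :: l).map fun y => o (i y)).reverse ++ S b) := by
      rw [update_comm hab.symm, update_idem, update_idem]
      simp
    rw [e] at h
    simpa [moveFrag, hl, hab.symm] using h

/-- Push a symbol on stack `b`, if there is one. -/
def pushOption {Λ : Type} (b : K) (f : T → Option (Γ b)) (d : Γ b) (q : Stmt Γ Λ (σ × Option T)) :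
    Stmt Γ Λ (σ × Option T) :=
  .branch (fun s => (s.2.bind f).isSome) (.push b (fun s => (s.2.bind f).getD d) q) q

theorem stepAux_pushOption {Λ : Type} (b : K) (f : T → Option (Γ b)) (d : Γ b)
    (q : Stmt Γ Λ (σ × Option T)) (s : σ × Option T) (S : ∀ k, List (Γ k)) :
    stepAux (pushOption b f d q) s S = stepAux q s (update S b ((s.2.bind f).toList ++ S b)) := by
  simp only [pushOption, stepAux]
  cases s.2.bind f <;> simp

/-- Move the content of stack `a` to the stacks `b` and `c`, reversing it. -/
def splitFrag (a b c : K) (i : Γ a → T) (f : T → Option (Γ b)) (g : T → Option (Γ c))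
    (d : Γ b) (d' : Γ c) : Frag Γ (σ × Option T) where
  Λ := Unit
  main := ()
  m _ := .pop a (fun s x => (s.1, x.map i)) <| .branch (fun s => s.2.isSome)
    (pushOption b f d <| pushOption c g d' <| .goto fun _ => ()) .halt

theorem splitFrag_runs {a b c : K} (hab : a ≠ b) (hac : a ≠ c) (hbc : b ≠ c) (i : Γ a → T)
    (f : T → Option (Γ b)) (g : T → Option (Γ c)) (d : Γ b) (d' : Γ c)
    (v : σ) (x : Option T) (S : ∀ k, List (Γ k)) :
    (splitFrag a b c i f g d d').Runs ((S a).length + 1) ((v, x), S)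
      ((v, none), update (update (update S a [])
        b (((S a).filterMap fun y => f (i y)).reverse ++ S b))
        c (((S a).filterMap fun y => g (i y)).reverse ++ S c)) := by
  generalize hl : S a = l
  induction l generalizing x S with
  | nil =>
    refine ⟨1, by simp, .head (n := 0) ?_⟩
    have : update S a [] = S := by rw [← hl, update_eq_self]
    simp only [splitFrag, stepAux, hl, List.head?_nil, Option.map_none, Option.isSome_none,
      cond_false, List.tail_nil, this, List.filterMap_nil, List.reverse_nil, List.nil_append,
      update_eq_self]
    exact .refl _
  | cons y l ih =>
    obtain ⟨n, hn, h⟩ := ih (some (i y)) (update (update (update S a l) b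
      ((f (i y)).toList ++ S b)) c ((g (i y)).toList ++ S c)) (by simp [hab, hac])
    refine ⟨n + 1, by simpa using hn, .head ?_⟩
    simp only [splitFrag, stepAux, hl, List.head?_cons, Option.map_some, Option.isSome_some,
      cond_true, List.tail_cons, stepAux_pushOption, Option.bind_some] at h ⊢
    convert h using 2
    · simp [hab.symm, hac.symm, hbc.symm]
    · funext k
      by_cases hkc : k = c
      · subst hkc
        cases hg : g (i y) <;> simp [hg]
      by_cases hkb : k = b
      · subst hkb
        cases hg : f (i y) <;> simp [hg, hbc]
      by_cases hka : k = a
      · subst hka; simp [hkb, hkc]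
      simp [hka, hkb, hkc]

end Moving

/-! ### Finite transducers, the source of the basic polynomial-time functions -/

section Mealy

variable {Q A B : Type}

/-- The output of a finite automaton with at most one symbol of output for each symbol of input,
and at most one at the end. -/
def mealy (δ : Q → A → Q × Option B) (fin : Q → Option B) : Q → List A → List B
  | q, [] => (fin q).toList
  | q, a :: l => (δ q a).2.toList ++ mealy δ fin (δ q a).1 l

theorem length_mealy_le (δ : Q → A → Q × Option B) (fin : Q → Option B) (q : Q) (l : List A) :
    (mealy δ fin q l).length ≤ l.length + 1 := by
  have h : ∀ o : Option B, o.toList.length ≤ 1 := by rintro (_ | _) <;> simp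
  induction l generalizing q with
  | nil => exact h _
  | cons a l ih =>
    have := ih (δ q a).1
    have := h (δ q a).2
    simp only [mealy, List.length_append, List.length_cons]
    omega

variable {K : Type} [DecidableEq K] {Γ : K → Type}

/-- Run a finite automaton on the content of stack `a`, with output on stack `b`, reversed. -/
def mealyFrag (a b : K) (δ : Q → Γ a → Q × Option (Γ b)) (fin : Q → Option (Γ b)) (q₀ : Q)
    (d : Γ b) : Frag Γ ((Q × Bool) × Option (Γ b)) where
  Λ := Unit
  main := ()
  m _ := .pop a (fun s x => x.elim ((s.1.1, true), fin s.1.1)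
      fun y => (((δ s.1.1 y).1, false), (δ s.1.1 y).2)) <|
    pushOption b some d <| .branch (fun s => s.1.2)
      (.load (fun _ => ((q₀, false), none)) .halt) (.goto fun _ => ())

theorem mealyFrag_runs {a b : K} (hab : a ≠ b) (δ : Q → Γ a → Q × Option (Γ b))
    (fin : Q → Option (Γ b)) (q₀ : Q) (d : Γ b) (s) (S : ∀ k, List (Γ k)) :
    (mealyFrag a b δ fin q₀ d).Runs ((S a).length + 1) (s, S)
      (((q₀, false), none), update (update S a []) b
        ((mealy δ fin s.1.1 (S a)).reverse ++ S b)) := by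
  generalize hl : S a = l
  induction l generalizing s S with
  | nil =>
    refine ⟨1, by simp, .head (n := 0) ?_⟩
    have : update S a [] = S := by rw [← hl, update_eq_self]
    simp only [mealyFrag, stepAux, hl, List.head?_nil, Option.elim_none, stepAux_pushOption,
      cond_true, List.tail_nil, this, mealy, Option.bind_fun_some]
    have e : (fin s.1.1).toList.reverse = (fin s.1.1).toList := by cases fin s.1.1 <;> rfl
    rw [e]
    exact .refl _
  | cons y l ih =>
    obtain ⟨n, hn, h⟩ := ih (((δ s.1.1 y).1, false), (δ s.1.1 y).2)
      (update (update S a l) b ((δ s.1.1 y).2.toList ++ S b)) (by simp [hab])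
    refine ⟨n + 1, by simpa using hn, .head ?_⟩
    simp only [mealyFrag, stepAux, hl, List.head?_cons, Option.elim_some, stepAux_pushOption,
      cond_false, List.tail_cons, mealy, Option.bind_fun_some] at h ⊢
    convert h using 2
    · simp [hab.symm]
    · funext k
      by_cases hkb : k = b
      · subst hkb
        cases hg : (δ s.1.1 y).2 <;> simp
      by_cases hka : k = a
      · subst hka; simp [hkb]
      simp [hka, hkb]

variable {α β : Type} {ea : α → List A} {eb : β → List B} {f : α → β}

/-- Stacks for a finite automaton: input, intermediate result, output. -/
abbrev MealyStack (A B : Type) : Option Bool → Type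
  | none => A
  | some _ => B

/-- One pass of the transducer leaves its output reversed on an intermediate stack; moving it to the
output stack restores the order. -/
theorem PolyTime.mealy [Fintype Q] [Fintype A] [Fintype B] [Inhabited B]
    (δ : Q → A → Q × Option B) (fin : Q → Option B) (q₀ : Q)
    (h : ∀ a, eb (f a) = NCCirc.mealy δ fin q₀ (ea a)) : PolyTime ea eb f := by
  let P : Frag (MealyStack A B) ((Q × Bool) × Option B) :=
    (mealyFrag (Γ := MealyStack A B) none (some false) δ fin q₀ (default : B)).seq
      (moveFrag (Γ := MealyStack A B) (some false) (some true) id id (default : B))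
  -- The passes take `l + 1` and at most `l + 2` steps, since a transducer emits at most `l + 1`
  -- symbols on input of length `l`.
  refine PolyTime.of_frag (Γ := MealyStack A B) P ((q₀, false), none) none (some true)
    (.refl A) (.refl B) (2 * .X + 3) fun a => ?_
  generalize hl : ea a = l
  have h₁ := mealyFrag_runs (Γ := MealyStack A B) (a := none) (b := some false) (by simp) δ fin q₀
    (default : B) ((q₀, false), none) (single none l)
  have h₂ := moveFrag_runs (Γ := MealyStack A B) (T := B) (a := some false) (b := some true)
    (by simp) id id (default : B) (q₀, false) none (update (update (single none l) none [])
      (some false) ((NCCirc.mealy δ fin q₀ l).reverse ++ []))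
  have hlen := length_mealy_le δ fin q₀ l
  have E : (eb (f a)).map (Equiv.refl B).symm = NCCirc.mealy δ fin q₀ l := by
    rw [h, hl, Equiv.refl_symm, Equiv.coe_refl, List.map_id]
  have E' : l.map (Equiv.refl A).symm = l := by simp
  rw [E, E']
  convert (h₁.seq h₂).mono (t' := (2 * .X + 3 : Polynomial ℕ).eval l.length) ?_ using 2
  · funext k
    rcases k with _ | _ | _
    · simp [single]
    · simp [single]
    · simp only [single_self, update_self, List.append_nil, List.map_id_fun', id]
      rw [List.reverse_reverse]
      simp [single]
  · simp [single]
    omega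

end Mealy

end NCCirc

namespace NCCirc

open Turing Turing.TM2 Function

/-! ### Machines on disjoint families of stacks -/

section Sum

variable {K₁ K₂ : Type} {Γ₁ : K₁ → Type} {Γ₂ : K₂ → Type}

/-- The alphabets of two families of stacks side by side. -/
abbrev SumStack (Γ₁ : K₁ → Type) (Γ₂ : K₂ → Type) : K₁ ⊕ K₂ → Type
  | .inl k => Γ₁ k
  | .inr k => Γ₂ k

/-- Two families of stacks side by side. -/
def stk2 (S : ∀ k, List (Γ₁ k)) (T : ∀ k, List (Γ₂ k)) : ∀ k, List (SumStack Γ₁ Γ₂ k)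
  | .inl k => S k
  | .inr k => T k

variable (S : ∀ k, List (Γ₁ k)) (T : ∀ k, List (Γ₂ k))

@[simp] theorem stk2_inl (k : K₁) : stk2 S T (.inl k) = S k := rfl

@[simp] theorem stk2_inr (k : K₂) : stk2 S T (.inr k) = T k := rfl

variable [DecidableEq K₁] [DecidableEq K₂]

@[simp] theorem update_stk2_inl (k : K₁) (l : List (Γ₁ k)) :
    update (stk2 S T) (.inl k) l = stk2 (update S k l) T := by
  funext k'
  rcases k' with k' | k'
  · by_cases h : k' = k
    · subst h; simp
    · simp [h]
  · simp

@[simp] theorem update_stk2_inr (k : K₂) (l : List (Γ₂ k)) :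
    update (stk2 S T) (.inr k) l = stk2 S (update T k l) := by
  funext k'
  rcases k' with k' | k'
  · simp
  · by_cases h : k' = k
    · subst h; simp
    · simp [h]

theorem single_inl (k : K₁) (l : List (Γ₁ k)) :
    single (Γ := SumStack Γ₁ Γ₂) (.inl k) l = stk2 (single k l) fun _ => [] := by
  have : (fun _ => [] : ∀ k, List (SumStack Γ₁ Γ₂ k)) = stk2 (fun _ => []) fun _ => [] := by
    funext k; rcases k <;> rfl
  rw [single, this, update_stk2_inl]; rfl

theorem single_inr (k : K₂) (l : List (Γ₂ k)) :
    single (Γ := SumStack Γ₁ Γ₂) (.inr k) l = stk2 (fun _ => []) (single k l) := by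
  have : (fun _ => [] : ∀ k, List (SumStack Γ₁ Γ₂ k)) = stk2 (fun _ => []) fun _ => [] := by
    funext k; rcases k <;> rfl
  rw [single, this, update_stk2_inr]; rfl

variable {σ : Type}

/-- A machine as a fragment that uses the first of two families of stacks. -/
def runLeft (Γ₂ : K₂ → Type) (tm : FinTM2) (get : σ → tm.σ) (set : σ → tm.σ → σ) :
    Frag (SumStack tm.Γ Γ₂) σ :=
  let _ := tm.ΛFin
  { Λ := tm.Λ, main := tm.main, m := fun l => embedStmt Sum.inl get set (tm.m l) }

/-- A machine as a fragment that uses the middle one of three families of stacks. -/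
def runMiddle {K₃ : Type} [DecidableEq K₃] (Γ₁ : K₁ → Type) (Γ₃ : K₃ → Type) (tm : FinTM2)
    (get : σ → tm.σ) (set : σ → tm.σ → σ) : Frag (SumStack Γ₁ (SumStack tm.Γ Γ₃)) σ :=
  let _ := tm.ΛFin
  { Λ := tm.Λ, main := tm.main, m := fun l => embedStmt (Sum.inr ∘ Sum.inl) get set (tm.m l) }

/-- The state `s` is the same before and after because a machine ends in the state in which it
starts. -/
theorem runLeft_runs {tm : FinTM2} {get : σ → tm.σ} {set : σ → tm.σ → σ} (hl : IsLens get set)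
    {n t : ℕ} (ht : n ≤ t) {S S' : ∀ k, List (tm.Γ k)} {s : σ} (hs : get s = tm.initialState)
    (h : Steps tm.m n ⟨some tm.main, tm.initialState, S⟩ ⟨none, tm.initialState, S'⟩) :
    (runLeft Γ₂ tm get set).Runs t (s, stk2 S T) (s, stk2 S' T) := by
  obtain ⟨S'', h₁, h₂, h₃⟩ := Steps.embed (Γ := SumStack tm.Γ Γ₂) Sum.inl_injective hl h s
    (stk2 S T) rfl
  have : S'' = stk2 S' T := by
    funext k
    rcases k with k | k
    · exact congrFun h₂ k
    · exact h₃ _ (by simp)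
  have hs' := hl.set_get s
  rw [hs] at hs'
  rw [this, hs'] at h₁
  exact ⟨n, ht, h₁⟩

theorem runMiddle_runs {K₃ : Type} [DecidableEq K₃] {Γ₃ : K₃ → Type} (U : ∀ k, List (Γ₃ k))
    {tm : FinTM2} {get : σ → tm.σ} {set : σ → tm.σ → σ}
    (hl : IsLens get set) {n t : ℕ} (ht : n ≤ t) {S' S'' : ∀ k, List (tm.Γ k)} {s : σ}
    (hs : get s = tm.initialState)
    (h : Steps tm.m n ⟨some tm.main, tm.initialState, S'⟩ ⟨none, tm.initialState, S''⟩) :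
    (runMiddle Γ₁ Γ₃ tm get set).Runs t (s, stk2 S (stk2 S' U)) (s, stk2 S (stk2 S'' U)) := by
  obtain ⟨S₀, h₁, h₂, h₃⟩ := Steps.embed (Γ := SumStack Γ₁ (SumStack tm.Γ Γ₃))
    (Sum.inr_injective.comp Sum.inl_injective) hl h s (stk2 S (stk2 S' U)) rfl
  have : S₀ = stk2 S (stk2 S'' U) := by
    funext k
    rcases k with k | k | k
    · exact h₃ _ (by simp)
    · exact congrFun h₂ k
    · exact h₃ _ (by simp)
  have hs' := hl.set_get s
  rw [hs] at hs'
  rw [this, hs'] at h₁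
  exact ⟨n, ht, h₁⟩

end Sum

/-! ### Closure of polynomial time under composition, pairing and bounded iteration -/

section Closure

variable {α β γ A B C : Type} {ea : α → List A} {eb : β → List B} {ec : γ → List C}
  {f : α → β}

/-- The two machines have separate stacks. The intermediate result passes through an extra stack,
being reversed twice, and its letters are translated from one stack alphabet to the other on the
way. -/
theorem PolyTime.comp {g : β → γ} [Fintype A] [Fintype B] [Inhabited B] (hg : PolyTime eb ec g)
    (hf : PolyTime ea eb f) : PolyTime ea ec (fun a => g (f a)) := by
  obtain ⟨r, hr⟩ := hf.length_le
  obtain ⟨M, iA, iB, p, hM⟩ := hf.exists_steps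
  obtain ⟨N, jB, jC, q, hN⟩ := hg.exists_steps
  have := M.kFin
  have := M.σFin
  have := N.kFin
  have := N.σFin
  let Γ := SumStack M.Γ (SumStack N.Γ fun _ : Unit => B)
  let P : Frag Γ ((M.σ × N.σ) × Option B) :=
    (((runLeft _ M (fun s => s.1.1) (fun s v => ((v, s.1.2), s.2))).seq
      (moveFrag (Γ := Γ) (.inl M.k₁) (.inr (.inr ())) iB id (default : B))).seq
      (moveFrag (Γ := Γ) (.inr (.inr ())) (.inr (.inl N.k₀)) id jB.symm (jB.symm default))).seq
      (runMiddle _ _ N (fun s => s.1.2) (fun s v => ((s.1.1, v), s.2)))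
  let _ : Fintype (Γ (.inl M.k₀)) := .ofEquiv A iA.symm
  -- Here `r` bounds the length of the intermediate result: two moves take `2 * r + 2` steps, and
  -- the second machine runs for `q` of that length.
  refine .of_frag P ((M.initialState, N.initialState), none) (.inl M.k₀) (.inr (.inl N.k₁)) iA jC
    (p + 2 * r + 2 + q.comp r) fun a => ?_
  obtain ⟨n, hn, h⟩ := hM a
  obtain ⟨n', hn', h'⟩ := hN (f a)
  have h₁ := runLeft_runs (Γ₂ := SumStack N.Γ fun _ : Unit => B) (fun _ => [])
    (get := fun s : (M.σ × N.σ) × Option B => s.1.1)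
    (set := fun s v => ((v, s.1.2), s.2)) ⟨fun _ _ => rfl, fun _ _ _ => rfl, fun _ => rfl⟩
    hn (s := ((M.initialState, N.initialState), none)) rfl h
  have h₂ := moveFrag_runs (Γ := Γ) (a := .inl M.k₁) (b := .inr (.inr ())) (by simp) iB id
    (default : B) (M.initialState, N.initialState) none
    (stk2 (single M.k₁ ((eb (f a)).map iB.symm)) fun _ => [])
  have h₃ := moveFrag_runs (Γ := Γ) (a := .inr (.inr ())) (b := .inr (.inl N.k₀)) (by simp) id
    jB.symm (jB.symm default) (M.initialState, N.initialState) none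
    (stk2 (fun _ => []) (stk2 (fun _ => []) (single () (eb (f a)).reverse)))
  have h₄ := runMiddle_runs (Γ₁ := M.Γ) (S := fun _ => [])
    (U := fun _ : Unit => ([] : List B)) (get := fun s : (M.σ × N.σ) × Option B => s.1.2)
    (set := fun s v => ((s.1.1, v), s.2)) ⟨fun _ _ => rfl, fun _ _ _ => rfl, fun _ => rfl⟩
    hn' (s := ((M.initialState, N.initialState), none)) rfl h'
  rw [show single (Γ := Γ) (.inl M.k₀) ((ea a).map iA.symm) = _ from single_inl _ _,
    show single (Γ := Γ) (.inr (.inl N.k₁)) ((ec (g (f a))).map jC.symm) = _ from single_inr _ _,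
    single_inl]
  have hnil : (fun _ => [] : ∀ k, List (SumStack N.Γ (fun _ : Unit => B) k)) =
      stk2 (fun _ => []) fun _ => [] := by
    funext k; rcases k <;> rfl
  have e₂ : update (update (stk2 (single M.k₁ ((eb (f a)).map iB.symm)) fun _ => [] :
      ∀ k, List (Γ k)) (.inl M.k₁) []) (.inr (.inr ()))
      ((((eb (f a)).map iB.symm).map fun y => id (iB y)).reverse ++ []) =
      stk2 (fun _ => []) (stk2 (fun _ => []) (single () (eb (f a)).reverse)) := by
    rw [hnil, update_stk2_inl, update_single, single_nil, update_stk2_inr, update_stk2_inr]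
    simp [single]
  have e₃ : update (update (stk2 (fun _ => []) (stk2 (fun _ => []) (single () (eb (f a)).reverse)) :
      ∀ k, List (Γ k)) (.inr (.inr ())) []) (.inr (.inl N.k₀))
      (((eb (f a)).reverse.map fun y => jB.symm (id y)).reverse ++ []) =
      stk2 (fun _ => []) (stk2 (single N.k₀ ((eb (f a)).map jB.symm)) fun _ => []) := by
    rw [update_stk2_inr, update_stk2_inr, update_stk2_inr, update_stk2_inl, update_single,
      single_nil]
    simp [single]
  simp only [stk2_inl, single_self, stk2_inr] at h₂ h₃
  rw [e₂] at h₂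
  rw [e₃] at h₃
  have hlen : (p.eval (ea a).length + (((eb (f a)).map iB.symm).length + 1) +
      ((eb (f a)).reverse.length + 1) + q.eval (eb (f a)).length ≤
      (p + 2 * r + 2 + q.comp r).eval (ea a).length) := by
    have := hr a
    have := eval_mono q this
    simp
    omega
  exact (((h₁.seq h₂).seq h₃).seq h₄).mono hlen

/-- The encoding of a pair, given encodings of the components. -/
def pairEnc (ea : α → List A) (eb : β → List B) (p : α × β) : List (A ⊕ B) :=
  (ea p.1).map .inl ++ (eb p.2).map .inr

@[simp] theorem update_unit {D : Type} (l l' : List D) (u : Unit) :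
    update (fun _ : Unit => l) u l' = fun _ => l' := by
  funext u; simp

theorem stk2_nil {K₁ K₂ : Type} {Γ₁ : K₁ → Type} {Γ₂ : K₂ → Type} :
    (fun _ => [] : ∀ k, List (SumStack Γ₁ Γ₂ k)) = stk2 (fun _ => []) fun _ => [] := by
  funext k; rcases k <;> rfl

/-- The input is parked on a temporary stack and then split into two copies, one for each machine. A
stack is filled from the bottom, so the second result is brought to the output stack before the
first. -/
theorem PolyTime.pair {g : α → γ} [Fintype A] [Fintype B] [Fintype C] [Inhabited A] [Inhabited B]
    (hf : PolyTime ea eb f) (hg : PolyTime ea ec g) :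
    PolyTime ea (pairEnc eb ec) (fun a => (f a, g a)) := by
  obtain ⟨r, hr⟩ := hf.length_le
  obtain ⟨r', hr'⟩ := hg.length_le
  obtain ⟨M, iA, iB, p, hM⟩ := hf.exists_steps
  obtain ⟨N, jA, jC, q, hN⟩ := hg.exists_steps
  have := M.kFin
  have := M.σFin
  have := N.kFin
  have := N.σFin
  let T := A ⊕ (B ⊕ C)
  let Γ := SumStack M.Γ (SumStack N.Γ (SumStack (fun _ : Unit => T) (fun _ : Unit => B ⊕ C)))
  let tmp : M.K ⊕ (N.K ⊕ (Unit ⊕ Unit)) := .inr (.inr (.inl ()))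
  let out : M.K ⊕ (N.K ⊕ (Unit ⊕ Unit)) := .inr (.inr (.inr ()))
  let F₁ : Frag Γ ((M.σ × N.σ) × Option T) :=
    moveFrag (Γ := Γ) (.inl M.k₀) tmp (fun x => .inl (iA x)) id (.inl default)
  let F₂ : Frag Γ ((M.σ × N.σ) × Option T) :=
    splitFrag (Γ := Γ) tmp (.inl M.k₀) (.inr (.inl N.k₀)) id
      (Sum.elim (fun a => some (iA.symm a)) fun _ => none)
      (Sum.elim (fun a => some (jA.symm a)) fun _ => none) (iA.symm default) (jA.symm default)
  let F₃ : Frag Γ ((M.σ × N.σ) × Option T) :=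
    runLeft _ M (fun s => s.1.1) (fun s v => ((v, s.1.2), s.2))
  let F₄ : Frag Γ ((M.σ × N.σ) × Option T) :=
    runMiddle _ _ N (fun s => s.1.2) (fun s v => ((s.1.1, v), s.2))
  let F₅ : Frag Γ ((M.σ × N.σ) × Option T) :=
    moveFrag (Γ := Γ) (.inr (.inl N.k₁)) tmp (fun x => .inr (.inr (jC x))) id (.inl default)
  let F₆ : Frag Γ ((M.σ × N.σ) × Option T) :=
    moveFrag (Γ := Γ) tmp out id (Sum.elim (fun _ => .inl default) id) (.inl default)
  let F₇ : Frag Γ ((M.σ × N.σ) × Option T) :=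
    moveFrag (Γ := Γ) (.inl M.k₁) tmp (fun x => .inr (.inl (iB x))) id (.inl default)
  let _ : Fintype (Γ (.inl M.k₀)) := .ofEquiv A iA.symm
  refine .of_frag (((((((F₁.seq F₂).seq F₃).seq F₄).seq F₅).seq F₆).seq F₇).seq F₆)
    ((M.initialState, N.initialState), none) (.inl M.k₀) out iA (.refl _)
    (2 * .X + 2 + p + q + 2 * r + 2 * r' + 4) fun a => ?_
  obtain ⟨n, hn, h⟩ := hM a
  obtain ⟨n', hn', h'⟩ := hN a
  have hra := hr a
  have hra' := hr' a
  simp only [pairEnc, Equiv.refl_symm]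
  generalize ea a = x at *
  generalize eb (f a) = y at *
  generalize ec (g a) = z at *
  let st (S₁ : ∀ k, List (M.Γ k)) (S₂ : ∀ k, List (N.Γ k)) (t : List T) (o : List (B ⊕ C)) :
      Store Γ ((M.σ × N.σ) × Option T) :=
    (((M.initialState, N.initialState), none),
      stk2 S₁ (stk2 S₂ (stk2 (fun _ => t) fun _ => o)))
  have h₁ : F₁.Runs (x.length + 1) (st (single M.k₀ (x.map iA.symm)) (fun _ => []) [] [])
      (st (fun _ => []) (fun _ => []) (x.map .inl).reverse []) := by
    have := moveFrag_runs (Γ := Γ) (a := .inl M.k₀) (b := tmp) (by simp [tmp])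
      (fun x => (.inl (iA x) : T)) id (.inl default) (M.initialState, N.initialState) none
      (st (single M.k₀ (x.map iA.symm)) (fun _ => []) [] []).2
    simpa [st, tmp, single_nil, Function.comp_def] using this
  have h₂ : F₂.Runs (x.length + 1) (st (fun _ => []) (fun _ => []) (x.map .inl).reverse [])
      (st (single M.k₀ (x.map iA.symm)) (single N.k₀ (x.map jA.symm)) [] []) := by
    have := splitFrag_runs (Γ := Γ) (a := tmp) (b := .inl M.k₀) (c := .inr (.inl N.k₀))
      (by simp [tmp]) (by simp [tmp]) (by simp) id
      (Sum.elim (fun a => some (iA.symm a)) fun _ => none)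
      (Sum.elim (fun a => some (jA.symm a)) fun _ => none) (iA.symm default) (jA.symm default)
      (M.initialState, N.initialState) none
      (st (fun _ => []) (fun _ => []) (x.map .inl).reverse []).2
    simpa [st, tmp, single, Function.comp_def, List.filterMap_map] using this
  have h₃ : F₃.Runs (p.eval x.length)
      (st (single M.k₀ (x.map iA.symm)) (single N.k₀ (x.map jA.symm)) [] [])
      (st (single M.k₁ (y.map iB.symm)) (single N.k₀ (x.map jA.symm)) [] []) :=
    runLeft_runs _ (get := fun s : (M.σ × N.σ) × Option T => s.1.1)
      (set := fun s v => ((v, s.1.2), s.2)) ⟨fun _ _ => rfl, fun _ _ _ => rfl, fun _ => rfl⟩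
      hn rfl h
  have h₄ : F₄.Runs (q.eval x.length)
      (st (single M.k₁ (y.map iB.symm)) (single N.k₀ (x.map jA.symm)) [] [])
      (st (single M.k₁ (y.map iB.symm)) (single N.k₁ (z.map jC.symm)) [] []) :=
    runMiddle_runs _ _ (get := fun s : (M.σ × N.σ) × Option T => s.1.2)
      (set := fun s v => ((s.1.1, v), s.2)) ⟨fun _ _ => rfl, fun _ _ _ => rfl, fun _ => rfl⟩
      hn' rfl h'
  have h₅ : F₅.Runs (z.length + 1)
      (st (single M.k₁ (y.map iB.symm)) (single N.k₁ (z.map jC.symm)) [] [])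
      (st (single M.k₁ (y.map iB.symm)) (fun _ => []) (z.map fun c => .inr (.inr c)).reverse []) := by
    have := moveFrag_runs (Γ := Γ) (a := .inr (.inl N.k₁)) (b := tmp) (by simp [tmp])
      (fun x => (.inr (.inr (jC x)) : T)) id (.inl default) (M.initialState, N.initialState) none
      (st (single M.k₁ (y.map iB.symm)) (single N.k₁ (z.map jC.symm)) [] []).2
    simpa [st, tmp, single_nil, Function.comp_def] using this
  have h₆ : F₆.Runs (z.length + 1)
      (st (single M.k₁ (y.map iB.symm)) (fun _ => []) (z.map fun c => .inr (.inr c)).reverse [])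
      (st (single M.k₁ (y.map iB.symm)) (fun _ => []) [] (z.map .inr)) := by
    have := moveFrag_runs (Γ := Γ) (a := tmp) (b := out) (by simp [tmp, out])
      id (Sum.elim (fun _ => .inl default) id) (.inl default) (M.initialState, N.initialState) none
      (st (single M.k₁ (y.map iB.symm)) (fun _ => [])
        (z.map fun c => .inr (.inr c)).reverse []).2
    simpa [st, tmp, out, Function.comp_def] using this
  have h₇ : F₇.Runs (y.length + 1)
      (st (single M.k₁ (y.map iB.symm)) (fun _ => []) [] (z.map .inr))
      (st (fun _ => []) (fun _ => []) (y.map fun c => .inr (.inl c)).reverse (z.map .inr)) := by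
    have := moveFrag_runs (Γ := Γ) (a := .inl M.k₁) (b := tmp) (by simp [tmp])
      (fun x => (.inr (.inl (iB x)) : T)) id (.inl default) (M.initialState, N.initialState) none
      (st (single M.k₁ (y.map iB.symm)) (fun _ => []) [] (z.map .inr)).2
    simpa [st, tmp, single_nil, Function.comp_def] using this
  have h₈ : F₆.Runs (y.length + 1)
      (st (fun _ => []) (fun _ => []) (y.map fun c => .inr (.inl c)).reverse (z.map .inr))
      (st (fun _ => []) (fun _ => []) [] (y.map .inl ++ z.map .inr)) := by
    have := moveFrag_runs (Γ := Γ) (a := tmp) (b := out) (by simp [tmp, out])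
      id (Sum.elim (fun _ => .inl default) id) (.inl default) (M.initialState, N.initialState) none
      (st (fun _ => []) (fun _ => []) (y.map fun c => .inr (.inl c)).reverse (z.map .inr)).2
    simpa [st, tmp, out, Function.comp_def] using this
  have := (((((((h₁.seq h₂).seq h₃).seq h₄).seq h₅).seq h₆).seq h₇).seq h₈).mono
    (t' := (2 * .X + 2 + p + q + 2 * r + 2 * r' + 4 : Polynomial ℕ).eval x.length) (by
      simp; omega)
  convert this using 2
  · rw [single_inl, stk2_nil, stk2_nil]
  · refine (single_inr _ _).trans (congrArg _ ((single_inr _ _).trans (congrArg _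
      ((single_inr _ _).trans (congrArg _ ?_)))))
    funext _
    exact (single_self _ _).trans (List.map_id _)

/-- The encoding of a natural number in unary. -/
def unaryEnc (n : ℕ) : List Unit := List.replicate n ()

@[simp] theorem reverse_unaryEnc (n : ℕ) : (unaryEnc n).reverse = unaryEnc n :=
  List.reverse_replicate ..

@[simp] theorem length_unaryEnc (n : ℕ) : (unaryEnc n).length = n := List.length_replicate

/-- The counter has its own stack, popped once per round, and the output is moved back to the input
stack through a temporary one. Polynomial time of `f` alone does not suffice, as iterates may grow
exponentially; `hr` bounds all intermediate results, hence the time of every round. -/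
theorem PolyTime.iterate {f : α → α} [Fintype A] [Inhabited A] (hf : PolyTime ea ea f)
    (r : Polynomial ℕ)
    (hr : ∀ n a, ∀ i ≤ n, (ea (f^[i] a)).length ≤ r.eval (n + (ea a).length)) :
    PolyTime (pairEnc unaryEnc ea) ea (fun p : ℕ × α => f^[p.1] p.2) := by
  obtain ⟨M, iA, iB, p, hM⟩ := hf.exists_steps
  have := M.kFin
  have := M.σFin
  let T := Unit ⊕ A
  let Γ := SumStack M.Γ (SumStack (fun _ : Unit => T)
    (SumStack (fun _ : Unit => Unit) (fun _ : Unit => A)))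
  let inp : M.K ⊕ (Unit ⊕ (Unit ⊕ Unit)) := .inr (.inl ())
  let cnt : M.K ⊕ (Unit ⊕ (Unit ⊕ Unit)) := .inr (.inr (.inl ()))
  let tmp : M.K ⊕ (Unit ⊕ (Unit ⊕ Unit)) := .inr (.inr (.inr ()))
  let F₁ : Frag Γ (M.σ × Option T) :=
    splitFrag (Γ := Γ) inp cnt tmp id (Sum.elim some fun _ => none) (Sum.elim (fun _ => none) some)
      () default
  let F₂ : Frag Γ (M.σ × Option T) :=
    moveFrag (Γ := Γ) tmp (.inl M.k₀) (fun x => .inr x)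
      (Sum.elim (fun _ => iA.symm default) iA.symm) (iA.symm default)
  let F₃ : Frag Γ (M.σ × Option T) := runLeft _ M (fun s => s.1) (fun s v => (v, s.2))
  let F₄ : Frag Γ (M.σ × Option T) :=
    moveFrag (Γ := Γ) (.inl M.k₁) tmp (fun x => .inr (iB x))
      (Sum.elim (fun _ => default) id) default
  let L : Frag Γ (M.σ × Option T) :=
    .loop (Γ := Γ) cnt (fun s o => (s.1, o.map .inl)) (fun s => s.2.isSome)
      (fun s => (s.1, none)) ((F₃.seq F₄).seq F₂)
  let _ : Fintype (Γ inp) := inferInstanceAs (Fintype (Unit ⊕ A))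
  refine .of_frag ((F₁.seq F₂).seq L) (M.initialState, none) inp (.inl M.k₀) (.refl _) iA
    (.X + 1 + (.X + 1) + (.X * (p.comp r + (r + 1) + (r + 1) + 1) + 1)) fun ⟨N, a⟩ => ?_
  simp only [pairEnc, Equiv.refl_symm]
  let st (S₁ : ∀ k, List (M.Γ k)) (t : List T) (c : List Unit) (o : List A) :
      Store Γ (M.σ × Option T) :=
    ((M.initialState, none), stk2 S₁ (stk2 (fun _ => t) (stk2 (fun _ => c) fun _ => o)))
  have h₁ (x : List A) : F₁.Runs (N + x.length + 1)
      (st (fun _ => []) ((unaryEnc N).map .inl ++ x.map .inr) [] [])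
      (st (fun _ => []) [] (unaryEnc N).reverse x.reverse) := by
    have := splitFrag_runs (Γ := Γ) (a := inp) (b := cnt) (c := tmp)
      (by simp [inp, cnt]) (by simp [inp, tmp]) (by simp [cnt, tmp]) id
      (Sum.elim some fun _ => none) (Sum.elim (fun _ => none) some)
      () default M.initialState none
      (st (fun _ => []) ((unaryEnc N).map .inl ++ x.map .inr) [] []).2
    simpa [-reverse_unaryEnc, st, inp, cnt, tmp, Function.comp_def, List.filterMap_append,
      List.filterMap_map] using this
  simp only [reverse_unaryEnc] at h₁
  have h₂ (x : List A) (c : List Unit) : F₂.Runs (x.length + 1)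
      (st (fun _ => []) [] c x.reverse) (st (single M.k₀ (x.map iA.symm)) [] c []) := by
    have := moveFrag_runs (Γ := Γ) (a := tmp) (b := .inl M.k₀) (by simp [tmp])
      (fun x => (.inr x : T)) (Sum.elim (fun _ => iA.symm default) iA.symm) (iA.symm default)
      M.initialState none (st (fun _ => []) [] c x.reverse).2
    simpa [st, tmp, single, Function.comp_def] using this
  have h₄ (x : List A) (c : List Unit) : F₄.Runs (x.length + 1)
      (st (single M.k₁ (x.map iB.symm)) [] c []) (st (fun _ => []) [] c x.reverse) := by
    have := moveFrag_runs (Γ := Γ) (a := .inl M.k₁) (b := tmp) (by simp [tmp])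
      (fun x => (.inr (iB x) : T)) (Sum.elim (fun _ => default) id) default
      M.initialState none (st (single M.k₁ (x.map iB.symm)) [] c []).2
    simpa [st, tmp, single_nil, Function.comp_def] using this
  set R := r.eval (N + (ea a).length) with hR
  have h₅ (i : ℕ) (hi : i < N) (c : List Unit) :
      ((F₃.seq F₄).seq F₂).Runs (p.eval R + (R + 1) + (R + 1))
        (st (single M.k₀ ((ea (f^[i] a)).map iA.symm)) [] c [])
        (st (single M.k₀ ((ea (f^[i + 1] a)).map iA.symm)) [] c []) := by
    obtain ⟨n, hn, h⟩ := hM (f^[i] a)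
    have h₃ : F₃.Runs (p.eval R) (st (single M.k₀ ((ea (f^[i] a)).map iA.symm)) [] c [])
        (st (single M.k₁ ((ea (f (f^[i] a))).map iB.symm)) [] c []) :=
      runLeft_runs _ (get := fun s : M.σ × Option T => s.1)
        (set := fun s v => (v, s.2)) ⟨fun _ _ => rfl, fun _ _ _ => rfl, fun _ => rfl⟩
        (hn.trans (eval_mono p (hr N a i hi.le))) rfl h
    rw [iterate_succ_apply']
    have := hr N a (i + 1) hi
    rw [iterate_succ_apply'] at this
    exact (h₃.seq ((h₄ _ _).mono (by omega))).seq ((h₂ _ _).mono (by omega))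
  have h₆ := Frag.Runs.loop (k := cnt) (n := N) (t := p.eval R + (R + 1) + (R + 1))
    (upd := fun s o => (s.1, o.map .inl)) (c := fun s => s.2.isSome)
    (reset := fun s => (s.1, none)) (P := (F₃.seq F₄).seq F₂)
    (fun i => st (single M.k₀ ((ea (f^[i] a)).map iA.symm)) [] (unaryEnc (N - i)) [])
    (fun i hi => by
      obtain ⟨j, hj⟩ : ∃ j, N - i = j + 1 := ⟨N - i - 1, by omega⟩
      simp [st, cnt, unaryEnc, hj, List.replicate_succ])
    (fun i hi => by
      obtain ⟨j, hj⟩ : ∃ j, N - i = j + 1 := ⟨N - i - 1, by omega⟩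
      have hj' : N - (i + 1) = j := by omega
      have := h₅ i hi (unaryEnc j)
      rw [hj, hj']
      simpa [st, cnt, unaryEnc, List.replicate_succ] using this)
    (by simp [st, cnt, unaryEnc])
  have h₇ := (((h₁ (ea a)).seq (h₂ (ea a) (unaryEnc N))).seq h₆).mono
    (t' := (.X + 1 + (.X + 1) + (.X * (p.comp r + (r + 1) + (r + 1) + 1) + 1) :
      Polynomial ℕ).eval ((unaryEnc N).map Sum.inl ++ (ea a).map Sum.inr).length) (by
      have : ((unaryEnc N).map Sum.inl ++ (ea a).map Sum.inr).length = N + (ea a).length := by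
        simp [unaryEnc]
      rw [this]
      simp only [Polynomial.eval_add, Polynomial.eval_X, Polynomial.eval_one, Polynomial.eval_mul,
        Polynomial.eval_comp, ← hR]
      gcongr <;> omega)
  convert h₇ using 2
  · refine (single_inr _ _).trans (congrArg _ ((single_inl _ _).trans ?_))
    rw [stk2_nil]
    congr 1
    funext _
    exact (single_self _ _).trans (List.map_id _)
  · simp only [Nat.sub_self, st]
    rfl
  · refine (single_inl _ _).trans ?_
    rw [stk2_nil, stk2_nil]
    simp [st, cnt, unaryEnc]

end Closure

end NCCirc

/-! ### A calculus of polynomial-time functions between coded types -/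

namespace NCCirc

open Function

/-- A type whose elements can be written down as strings over a finite alphabet. -/
class Coded (α : Type) where
  /-- the alphabet -/
  Alph : Type
  [fin : Fintype Alph]
  [inh : Inhabited Alph]
  /-- the string describing an element -/
  enc : α → List Alph

attribute [instance] Coded.fin Coded.inh

/-- A finite alphabet. -/
class Letter (α : Type) extends Fintype α, Inhabited α

instance : Letter Bool where
instance : Letter Unit where
instance {A : Type} [Letter A] : Letter (Option A) where

instance {A : Type} [Letter A] : Coded A := ⟨A, fun a => [a]⟩
instance {A : Type} [Letter A] : Coded (List A) := ⟨A, fun l => l⟩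
instance : Coded ℕ := ⟨Unit, unaryEnc⟩
instance {α β : Type} [Coded α] [Coded β] : Coded (α × β) :=
  ⟨Coded.Alph α ⊕ Coded.Alph β, pairEnc Coded.enc Coded.enc⟩

/-- The length of the description. -/
def size {α : Type} [Coded α] (a : α) : ℕ := (Coded.enc a).length

/-- Polynomial time functions. -/
@[fun_prop]
def Poly {α β : Type} [Coded α] [Coded β] (f : α → β) : Prop :=
  PolyTime (Coded.enc (α := α)) (Coded.enc (α := β)) f

/-- A machine sees only strings, so the same machine serves for any function whose values have the
same descriptions. -/
theorem PolyTime.congr {α β β' A B : Type} {ea : α → List A} {eb : β → List B}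
    {eb' : β' → List B} {f : α → β} {f' : α → β'} (h : PolyTime ea eb f)
    (hf : ∀ a, eb' (f' a) = eb (f a)) : PolyTime ea eb' f' := by
  obtain ⟨M⟩ := h
  exact ⟨{ M with outputsFun := fun a => by rw [hf]; exact M.outputsFun a }⟩

section

variable {α β γ ε A B C : Type} [Coded α] [Coded β] [Coded γ] [Coded ε] [Letter A] [Letter B]
  [Letter C]

@[simp] theorem size_prod (p : α × β) : size p = size p.1 + size p.2 := by
  simp [size, Coded.enc, pairEnc]

@[simp] theorem size_nat (n : ℕ) : size n = n := length_unaryEnc n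

@[simp] theorem size_list (l : List A) : size l = l.length := rfl

@[simp] theorem size_letter (a : A) : size a = 1 := rfl

namespace Poly

theorem length_le {f : α → β} (hf : Poly f) : ∃ p : Polynomial ℕ, ∀ a, size (f a) ≤ p.eval (size a) :=
  PolyTime.length_le hf

@[fun_prop]
theorem comp {g : β → γ} {f : α → β} (hg : Poly g) (hf : Poly f) : Poly (fun a => g (f a)) :=
  PolyTime.comp hg hf

@[fun_prop]
theorem prodMk {f : α → β} {g : α → γ} (hf : Poly f) (hg : Poly g) : Poly (fun a => (f a, g a)) :=
  PolyTime.pair hf hg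

theorem mealy_filterMap {D E : Type} (φ : D → Option E) (l : List D) :
    NCCirc.mealy (fun (_ : Unit) d => ((), φ d)) (fun _ => none) () l = l.filterMap φ := by
  induction l with
  | nil => rfl
  | cons d l ih =>
    rw [mealy, ih, List.filterMap_cons]
    cases φ d <;> rfl

theorem of_filterMap {f : α → β} (φ : Coded.Alph α → Option (Coded.Alph β))
    (h : ∀ a, Coded.enc (f a) = (Coded.enc a).filterMap φ) : Poly f :=
  PolyTime.mealy (fun (_ : Unit) d => ((), φ d)) (fun _ => none) () fun a => by
    rw [h, mealy_filterMap]

@[fun_prop]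
theorem id : Poly (fun a : α => a) := of_filterMap some fun _ => (List.filterMap_some).symm

@[fun_prop]
theorem fst : Poly (Prod.fst : α × β → α) :=
  of_filterMap (Sum.elim some fun _ => none) fun p => by
    simp [Coded.enc, pairEnc, List.filterMap_append, List.filterMap_map, comp_def]

@[fun_prop]
theorem snd : Poly (Prod.snd : α × β → β) :=
  of_filterMap (Sum.elim (fun _ => none) some) fun p => by
    simp [Coded.enc, pairEnc, List.filterMap_append, List.filterMap_map, comp_def]

theorem append_aux : Poly (fun p : List A × List A => p.1 ++ p.2) :=
  of_filterMap (Sum.elim some some) fun p => by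
    simp [Coded.enc, pairEnc, List.filterMap_append, List.filterMap_map, comp_def]

@[fun_prop]
theorem append {f g : α → List A} (hf : Poly f) (hg : Poly g) : Poly (fun a => f a ++ g a) :=
  append_aux.comp (hf.prodMk hg)

theorem const_nil_or_letter (o : Option A) : Poly (fun _ : α => o.toList) :=
  PolyTime.mealy (fun (_ : Unit) _ => ((), none)) (fun _ => o) () fun a => by
    generalize Coded.enc a = l
    induction l with
    | nil => rfl
    | cons d l ih => exact ih

-- Only the describing string matters, and a constant string is produced letter by letter by
-- appending.
@[fun_prop]
theorem const (c : β) : Poly (fun _ : α => c) := by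
  have : ∀ l : List (Coded.Alph β), PolyTime (Coded.enc (α := α)) (fun l => l) (fun _ : α => l) := by
    let _ : Letter (Coded.Alph β) := { }
    intro l
    induction l with
    | nil => exact const_nil_or_letter none
    | cons a l ih => exact append (const_nil_or_letter (some a)) ih
  exact (this (Coded.enc c)).congr fun _ => rfl

theorem toList_aux : Poly (fun a : A => [a]) := of_filterMap some fun _ => rfl

@[fun_prop]
theorem singleton {f : α → A} (hf : Poly f) : Poly (fun a => [f a]) := toList_aux.comp hf

@[fun_prop]
theorem cons {f : α → A} {g : α → List A} (hf : Poly f) (hg : Poly g) :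
    Poly (fun a => f a :: g a) := append hf.singleton hg

theorem letter_aux (φ : A → B) : Poly φ := of_filterMap (fun a => some (φ a)) fun _ => rfl

theorem letter (φ : A → B) {f : α → A} (hf : Poly f) : Poly (fun a => φ (f a)) :=
  (letter_aux φ).comp hf

theorem letter₂_aux (φ : A → B → C) : Poly (fun p : A × B => φ p.1 p.2) :=
  PolyTime.mealy (Q := A)
    (fun q => Sum.elim (fun a : A => (a, none)) fun b : B => (q, some (φ q b)))
    (fun _ => none) default fun _ => rfl

theorem letter₂ (φ : A → B → C) {f : α → A} {g : α → B} (hf : Poly f) (hg : Poly g) :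
    Poly (fun a => φ (f a) (g a)) := (letter₂_aux φ).comp (hf.prodMk hg)

@[fun_prop]
theorem and {f g : α → Bool} (hf : Poly f) (hg : Poly g) : Poly (fun a => f a && g a) :=
  letter₂ _ hf hg

@[fun_prop]
theorem or {f g : α → Bool} (hf : Poly f) (hg : Poly g) : Poly (fun a => f a || g a) :=
  letter₂ _ hf hg

@[fun_prop]
theorem not {f : α → Bool} (hf : Poly f) : Poly (fun a => !f a) := letter _ hf

/-- The Boolean is the first letter of the description, so a transducer can remember it and keep the
letters of one branch only. -/
theorem cond_aux : Poly (fun p : Bool × β × β => cond p.1 p.2.1 p.2.2) := by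
  refine PolyTime.mealy (Q := Bool)
    (fun q => Sum.elim (fun b : Bool => (b, none)) <| Sum.elim
      (fun x => (q, if q then some x else none)) (fun x => (q, if q then none else some x)))
    (fun _ => none) false ?_
  rintro ⟨b, x, y⟩
  have h (l : List (Coded.Alph β ⊕ Coded.Alph β)) : NCCirc.mealy (Q := Bool)
      (fun q => Sum.elim (fun b : Bool => (b, none)) <| Sum.elim
        (fun x => (q, if q then some x else none)) (fun x => (q, if q then none else some x)))
      (fun _ => none) b (l.map .inr) = l.filterMap (bif b then Sum.elim some (fun _ => none) else
        Sum.elim (fun _ => none) some) := by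
    induction l with
    | nil => rfl
    | cons d l ih => cases b <;> cases d <;> simp_all [mealy, List.filterMap_cons]
  refine Eq.trans ?_ (h _).symm
  cases b <;> simp [Coded.enc, pairEnc, List.filterMap_append, List.filterMap_map, comp_def]

@[fun_prop]
theorem cond {c : α → Bool} {f g : α → β} (hc : Poly c) (hf : Poly f) (hg : Poly g) :
    Poly (fun a => cond (c a) (f a) (g a)) := cond_aux.comp (hc.prodMk (hf.prodMk hg))

open Classical in
-- There are finitely many possible values of `g a`. Each may have its own machine for `f x`, with
-- no uniformity in `x`, and a chain of conditionals selects among them.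
theorem cases {f : A → α → β} {g : α → A} (hg : Poly g) (hf : ∀ x, Poly (f x)) :
    Poly (fun a => f (g a) a) := by
  have h : ∀ l : List A, Poly (fun a => if g a ∈ l then f (g a) a else f default a) := by
    intro l
    induction l with
    | nil => simpa using hf default
    | cons x l ih =>
      have : (fun a => if g a ∈ x :: l then f (g a) a else f default a) = fun a =>
          _root_.cond (decide (g a = x)) (f x a) (if g a ∈ l then f (g a) a else f default a) := by
        funext a
        by_cases h : g a = x <;> simp [h]
      rw [this]
      exact (letter (fun y => decide (y = x)) hg).cond (hf x) ih
  simpa using h (Finset.univ.toList)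

theorem mealyList {Q : Type} [Fintype Q] (δ : Q → A → Q × Option B) (fin : Q → Option B) (q₀ : Q)
    {f : α → List A} (hf : Poly f) : Poly (fun a => NCCirc.mealy δ fin q₀ (f a)) :=
  Poly.comp (g := NCCirc.mealy δ fin q₀) (PolyTime.mealy δ fin q₀ fun _ => rfl) hf

theorem head?_aux : Poly (List.head? : List A → Option A) := by
  refine PolyTime.mealy (Q := Bool)
    (fun q a => (true, if q then none else some (some a)))
    (fun q => if q then none else some none) false ?_
  have (l : List A) : NCCirc.mealy (B := Option A) (fun q a => (true, if q then none else some (some a)))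
    (fun q => if q then none else some none) true l = [] := by
    induction l with
    | nil => rfl
    | cons a l ih => simpa [mealy] using ih
  rintro (_ | ⟨a, l⟩)
  · rfl
  · refine Eq.trans ?_ (congrArg (some a :: ·) (this l).symm)
    rfl

@[fun_prop]
theorem head? {f : α → List A} (hf : Poly f) : Poly (fun a => (f a).head?) := head?_aux.comp hf

theorem tail_aux {D : Type} (l : List D) :
    NCCirc.mealy (fun q a => (true, if q = true then some a else none))
      (fun _ => none) false l = l.tail := by
  have (l : List D) : NCCirc.mealy (fun q a => (true, if q = true then some a else none))
      (fun _ => none) true l = l := by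
    induction l with
    | nil => rfl
    | cons a l ih => simpa [mealy] using ih
  rcases l with _ | ⟨a, l⟩
  · rfl
  · exact this l

@[fun_prop]
theorem tail {f : α → List A} (hf : Poly f) : Poly (fun a => (f a).tail) := by
  simpa only [tail_aux] using mealyList (fun q a => (true, if q = true then some a else none))
      (fun _ => none) false hf

@[fun_prop]
theorem isEmpty {f : α → List A} (hf : Poly f) : Poly (fun a => (f a).isEmpty) := by
  have := letter (fun o : Option A => o.isNone) hf.head?
  refine this.congr fun a => ?_
  cases h : f a <;> rfl

@[fun_prop]
theorem filterMap (φ : A → Option B) {f : α → List A} (hf : Poly f) :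
    Poly (fun a => (f a).filterMap φ) := by
  simpa only [mealy_filterMap] using mealyList (fun (_ : Unit) d => ((), φ d)) (fun _ => none) () hf

@[fun_prop]
theorem map (φ : A → B) {f : α → List A} (hf : Poly f) : Poly (fun a => (f a).map φ) := by
  simpa using filterMap (fun a => some (φ a)) hf

/-- Functions with the same values in terms of strings. -/
theorem transfer {β' : Type} [Coded β'] {f : α → β} (g : β → β')
    (e : Coded.Alph β → Coded.Alph β') (hf : Poly f)
    (hg : ∀ b, Coded.enc (g b) = (Coded.enc b).map e) : Poly (fun a => g (f a)) :=
  comp (of_filterMap (fun a => some (e a)) fun b => by simp [hg]) hf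

@[fun_prop]
theorem length {f : α → List A} (hf : Poly f) : Poly (fun a => (f a).length) :=
  transfer List.length (fun _ => ()) hf fun l =>
    (List.map_const' : List.map (fun _ => ()) l = List.replicate l.length ()).symm

@[fun_prop]
theorem replicate (b : A) {f : α → ℕ} (hf : Poly f) : Poly (fun a => List.replicate (f a) b) :=
  transfer (fun n => List.replicate n b) (fun _ => b) hf fun n =>
    (List.map_replicate : List.map (fun _ => b) (List.replicate n ()) = List.replicate n b).symm

@[fun_prop]
theorem add {f g : α → ℕ} (hf : Poly f) (hg : Poly g) : Poly (fun a => f a + g a) := by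
  simpa using ((replicate () hf).append (replicate () hg)).length

@[fun_prop]
theorem pred {f : α → ℕ} (hf : Poly f) : Poly (fun a => f a - 1) := by
  simpa using (replicate () hf).tail.length

@[fun_prop]
theorem isZero {f : α → ℕ} (hf : Poly f) : Poly (fun a => f a == 0) := by
  have := (replicate () hf).isEmpty
  refine this.congr fun a => ?_
  cases f a <;> rfl

end Poly

end

end NCCirc

/-! ### Bounded recursion, list operations and arithmetic in unary -/

namespace NCCirc

open Function

section

variable {α β γ ε A B C : Type} [Coded α] [Coded β] [Coded γ] [Coded ε] [Letter A] [Letter B]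
  [Letter C]

theorem eval_le_eval_add (p : Polynomial ℕ) (m n : ℕ) : p.eval m ≤ p.eval (m + n) :=
  eval_mono p (Nat.le_add_right m n)

namespace Poly

theorem iterate {f : α → α} (hf : Poly f) (r : Polynomial ℕ)
    (hr : ∀ n a, ∀ i ≤ n, size (f^[i] a) ≤ r.eval (n + size a)) :
    Poly (fun p : ℕ × α => f^[p.1] p.2) :=
  PolyTime.iterate hf r hr

/-- Primitive recursion with parameters, where each step adds at most polynomially much to the
length of the value. -/
theorem natRec {base : ε → α} {step : ε → ℕ → α → α} {n : ε → ℕ} (hb : Poly base)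
    (hs : Poly (fun p : ε × ℕ × α => step p.1 p.2.1 p.2.2)) (hn : Poly n) (r : Polynomial ℕ)
    (hr : ∀ e i a, size (step e i a) ≤ size a + r.eval (size e + i)) :
    Poly (fun e => Nat.rec (motive := fun _ => α) (base e) (step e) (n e)) := by
  -- Iteration has no parameters and no index, so both are carried along in the value.
  let f : ε × ℕ × α → ε × ℕ × α := fun p => (p.1, p.2.1 + 1, step p.1 p.2.1 p.2.2)
  have hf : Poly f := by fun_prop
  have key : ∀ p : ε × ℕ × α, ∀ i, (f^[i] p).1 = p.1 ∧ (f^[i] p).2.1 = p.2.1 + i ∧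
      size (f^[i] p).2.2 ≤ size p.2.2 + i * r.eval (size p.1 + p.2.1 + i) := by
    intro p i
    induction i with
    | zero => simp
    | succ i ih =>
      rw [iterate_succ_apply']
      refine ⟨ih.1, by simp [f, ih.2.1, add_assoc], (hr _ _ _).trans ?_⟩
      rw [ih.1, ih.2.1, add_mul]
      have h₁ := eval_mono r (show size p.1 + p.2.1 + i ≤ size p.1 + p.2.1 + (i + 1) by omega)
      have h₂ := Nat.mul_le_mul_left i h₁
      have h₃ : size p.1 + (p.2.1 + i) = size p.1 + p.2.1 + i := by omega
      rw [h₃]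
      omega
  have hit : Poly (fun p : ℕ × ε × ℕ × α => f^[p.1] p.2) := by
    -- The product bounds at most `n` increments of the value; the other `.X` covers the parameter,
    -- the index and the initial value.
    refine iterate hf (.X + .X * r) fun n p i hi => ?_
    obtain ⟨h₁, h₂, h₃⟩ := key p i
    simp only [size_prod, h₁, h₂, size_nat, Polynomial.eval_add, Polynomial.eval_mul,
      Polynomial.eval_X] at h₃ ⊢
    have h₄ := Nat.mul_le_mul (show i ≤ n + (size p.1 + (p.2.1 + size p.2.2)) by omega)
      (eval_mono r (show size p.1 + p.2.1 + i ≤ n + (size p.1 + (p.2.1 + size p.2.2)) by omega))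
    omega
  have h : ∀ e n, (f^[n] (e, 0, base e)).2.2 =
      Nat.rec (motive := fun _ => α) (base e) (step e) n := by
    intro e n
    induction n with
    | zero => rfl
    | succ n ih =>
      rw [iterate_succ_apply']
      obtain ⟨h₁, h₂, -⟩ := key (e, 0, base e) n
      simp only [f, h₁, h₂, ih, zero_add]
  have : Poly (fun e => (f^[n e] (e, 0, base e)).2.2) := by fun_prop
  simpa only [h] using this

/-- Left folds, where each step adds at most polynomially much to the length of the value. -/
theorem foldl {f : ε → α → A → α} {l : ε → List A} {init : ε → α} (hl : Poly l) (hi : Poly init)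
    (hf : ∀ a, Poly (fun p : ε × α => f p.1 p.2 a)) (r : Polynomial ℕ)
    (hr : ∀ e s a, size (f e s a) ≤ size s + r.eval (size e)) :
    Poly (fun e => (l e).foldl (f e) (init e)) := by
  -- The letters still to be read are part of the value. Their number only decreases, so the growth
  -- bound for `f` carries over.
  let g : ε → ℕ → List A × α → List A × α := fun e _ s =>
    (s.1.tail, s.1.head?.elim s.2 (f e s.2))
  have hg : Poly (fun p : ε × ℕ × List A × α => g p.1 p.2.1 p.2.2) := by
    refine prodMk (by fun_prop) ?_
    refine cases (f := fun (o : Option A) (p : ε × ℕ × List A × α) => o.elim p.2.2.2 (f p.1 p.2.2.2))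
      (g := fun p => p.2.2.1.head?) (by fun_prop) ?_
    rintro (_ | a)
    · change Poly (fun p : ε × ℕ × List A × α => p.2.2.2)
      fun_prop
    · exact (hf a).comp (f := fun p : ε × ℕ × List A × α => (p.1, p.2.2.2)) (by fun_prop)
  have := natRec (base := fun e => (l e, init e)) (step := g) (n := fun e => (l e).length)
    (by fun_prop) hg (by fun_prop) r (fun e i s => by
      have hle := eval_le_eval_add r (size e) i
      rcases s with ⟨_ | ⟨a, l⟩, s⟩
      · simp [g]
      · have := hr e s a
        simp [g]
        omega)
  have h : ∀ e (l : List A) s n (hn : l.length = n), (Nat.rec (motive := fun _ => List A × α)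
      (l, s) (g e) n).2 = l.foldl (f e) s := by
    -- Recursion unfolds at its last step, a left fold at its first letter. As `g` ignores the
    -- index, the first step can be split off as well.
    have h' : ∀ e (p : List A × α) n, Nat.rec (motive := fun _ => List A × α) p (g e) (n + 1) =
        Nat.rec (motive := fun _ => List A × α) (g e 0 p) (g e) n := by
      intro e p n
      induction n with
      | zero => rfl
      | succ n ih => exact congrArg (g e 0) ih
    intro e l s n hn
    induction n generalizing l s with
    | zero => cases l <;> simp_all
    | succ n ih =>
      rw [h']
      rcases l with _ | ⟨a, l⟩
      · simp at hn
      · exact ih l (f e s a) (by simpa using hn)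
  simpa only [h _ _ _ _ rfl] using Poly.snd.comp this

@[fun_prop]
theorem reverse {f : α → List A} (hf : Poly f) : Poly (fun a => (f a).reverse) := by
  have : Poly (fun l : List A => l.foldl (fun acc a => a :: acc) []) :=
    foldl (f := fun (_ : List A) acc a => a :: acc) (by fun_prop) (by fun_prop)
      (fun a => by fun_prop) 1 (fun _ _ _ => by simp)
  simpa [List.foldl_flip_cons_eq_append'] using this.comp hf

@[fun_prop]
theorem drop {n : α → ℕ} {f : α → List A} (hn : Poly n) (hf : Poly f) :
    Poly (fun a => (f a).drop (n a)) := by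
  have := natRec (step := fun _ _ l => l.tail) hf (by fun_prop) hn 0 (fun _ _ _ => by simp)
  have h : ∀ (l : List A) n, Nat.rec (motive := fun _ => List A) l (fun _ l => l.tail) n =
      l.drop n := by
    intro l n
    induction n with
    | zero => rfl
    | succ n ih => simp only [ih, List.tail_drop]
  simpa only [h] using this

theorem getElem? {n : α → ℕ} {f : α → List A} (hn : Poly n) (hf : Poly f) :
    Poly (fun a => (f a)[n a]?) := by
  simpa using (drop hn hf).head?

@[fun_prop]
theorem getD {n : α → ℕ} {f : α → List A} (d : A) (hn : Poly n) (hf : Poly f) :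
    Poly (fun a => (f a).getD (n a) d) := by
  simpa [List.getD] using letter (fun o : Option A => o.getD d) (getElem? hn hf)

@[fun_prop]
theorem sub {f g : α → ℕ} (hf : Poly f) (hg : Poly g) : Poly (fun a => f a - g a) := by
  simpa using (drop hg (replicate () hf)).length

theorem natDecEq {f g : α → ℕ} (hf : Poly f) (hg : Poly g) : Poly (fun a => decide (f a = g a)) := by
  have : Poly (fun a => (f a - g a == 0) && (g a - f a == 0)) := by fun_prop
  refine this.congr fun a => congrArg _ ?_
  rw [Bool.eq_iff_iff]
  simp
  omega

theorem natDecLt {f g : α → ℕ} (hf : Poly f) (hg : Poly g) : Poly (fun a => decide (f a < g a)) := by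
  have : Poly (fun a => !(g a - f a == 0)) := by fun_prop
  refine this.congr fun a => congrArg _ ?_
  rw [Bool.eq_iff_iff]
  simp
  omega

/-- Concatenation of strings indexed by the numbers below a bound. -/
theorem flatMap_range {n : ε → ℕ} {f : ε → ℕ → List A} (hn : Poly n)
    (hf : Poly (fun p : ε × ℕ => f p.1 p.2)) : Poly (fun e => (List.range (n e)).flatMap (f e)) := by
  obtain ⟨r, hr⟩ := hf.length_le
  have := natRec (base := fun _ : ε => ([] : List A)) (step := fun e i l => l ++ f e i) (n := n)
    (by fun_prop) (append (f := fun p : ε × ℕ × List A => p.2.2) (by fun_prop)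
      (hf.comp (f := fun p : ε × ℕ × List A => (p.1, p.2.1)) (by fun_prop)))
    hn r (fun e i l => by
      have := hr (e, i)
      simp at this ⊢
      omega)
  have h : ∀ e n, Nat.rec (motive := fun _ => List A) [] (fun i l => l ++ f e i) n =
      (List.range n).flatMap (f e) := by
    intro e n
    induction n with
    | zero => rfl
    | succ n ih => simp only [ih, List.range_succ, List.flatMap_append, List.flatMap_singleton]
  simpa only [h] using this

@[fun_prop]
theorem mul {f g : α → ℕ} (hf : Poly f) (hg : Poly g) : Poly (fun a => f a * g a) := by
  have := (flatMap_range (f := fun a _ => List.replicate (g a) ()) hf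
    (replicate () (hg.comp fst))).length
  simpa using this

theorem eval (p : Polynomial ℕ) {f : α → ℕ} (hf : Poly f) : Poly (fun a => p.eval (f a)) := by
  induction p using Polynomial.induction_on with
  | C a => simpa using const a
  | add p q hp hq => simpa using hp.add hq
  | monomial n a ih =>
    simp only [pow_succ, ← mul_assoc, Polynomial.eval_mul (q := Polynomial.X), Polynomial.eval_X]
    exact ih.mul hf

end Poly

end

end NCCirc

/-! ### Evaluating a circuit from its description -/

namespace NCCirc

open Function

instance : Finite Symbol :=
  Finite.of_injective (β := Fin 5)
    (fun | .tick => 0 | .sep => 1 | .andSym => 2 | .orSym => 3 | .notSym => 4)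
    (by rintro (_ | _) (_ | _) <;> simp)

noncomputable instance : Letter Symbol where
  toFintype := Fintype.ofFinite _
  default := .tick

/-- What is being read when a circuit is evaluated from its description: the width, the first
symbol of a gate or a number of an output, or a number of an input of a gate. -/
inductive ReadMode where
  | width | ready | and₁ | and₂ | or₁ | or₂ | not₁

instance : Finite ReadMode :=
  Finite.of_injective (β := Fin 7)
    (fun | .width => 0 | .ready => 1 | .and₁ => 2 | .and₂ => 3 | .or₁ => 4 | .or₂ => 5 | .not₁ => 6)
    (by rintro (_ | _) (_ | _) <;> simp)

noncomputable instance : Letter ReadMode where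
  toFintype := Fintype.ofFinite _
  default := .width

/-- The state of the evaluation of a circuit from its description: the mode, the values of the
wires, two numbers of wires, whether the outputs have been as expected up to now, and the outputs
expected from now on. -/
abbrev ReadState := ReadMode × List Bool × ℕ × ℕ × Bool × List Bool

/-- Read one symbol of the description of a circuit. -/
def readSymbol (a : Symbol) (m : ReadMode) (s : List Bool × ℕ × ℕ × Bool × List Bool) :
    ReadState :=
  match m, a with
  | .width, .sep => (.ready, s)
  | .ready, .tick => (.ready, s.1, s.2.1 + 1, s.2.2)
  | .ready, .sep => (.ready, s.1, 0, 0,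
      s.2.2.2.1 && (s.2.2.2.2.head? == some (s.1.getD s.2.1 false)), s.2.2.2.2.tail)
  | .ready, .andSym => (.and₁, s)
  | .ready, .orSym => (.or₁, s)
  | .ready, .notSym => (.not₁, s)
  | .and₁, .tick => (.and₁, s.1, s.2.1 + 1, s.2.2)
  | .and₁, .sep => (.and₂, s)
  | .or₁, .tick => (.or₁, s.1, s.2.1 + 1, s.2.2)
  | .or₁, .sep => (.or₂, s)
  | .and₂, .tick => (.and₂, s.1, s.2.1, s.2.2.1 + 1, s.2.2.2)
  | .and₂, .sep =>
    (.ready, s.1 ++ [s.1.getD s.2.1 false && s.1.getD s.2.2.1 false], 0, 0, s.2.2.2)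
  | .or₂, .tick => (.or₂, s.1, s.2.1, s.2.2.1 + 1, s.2.2.2)
  | .or₂, .sep =>
    (.ready, s.1 ++ [s.1.getD s.2.1 false || s.1.getD s.2.2.1 false], 0, 0, s.2.2.2)
  | .not₁, .tick => (.not₁, s.1, s.2.1 + 1, s.2.2)
  | .not₁, .sep => (.ready, s.1 ++ [!s.1.getD s.2.1 false], 0, 0, s.2.2.2)
  | m, _ => (m, s)

/-- Read one symbol of the description of a circuit. -/
def readStep (s : ReadState) (a : Symbol) : ReadState := readSymbol a s.1 s.2

@[simp] theorem readStep_mk (m : ReadMode) (s) (a : Symbol) :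
    readStep (m, s) a = readSymbol a m s := rfl

/-- Evaluate a circuit, given by its description, on the input `w`, and compare the output
with `w`. -/
def checkFixed (c : List Symbol) (w : List Bool) : Bool :=
  let s := c.foldl readStep ((.width, w, 0, 0, true, w) : ReadState)
  s.2.2.2.2.1 && s.2.2.2.2.2.isEmpty

/-- The description is read once from left to right with a state of polynomial size. For each symbol
and mode the change of state is a composition of basic functions. -/
theorem poly_checkFixed : Poly (fun p : List Symbol × List Bool => checkFixed p.1 p.2) := by
  have hbeq {f : List Bool × ℕ × ℕ × Bool × List Bool → Option Bool} {g} (hf : Poly f)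
      (hg : Poly g) : Poly (fun s => f s == some (g s)) :=
    .letter₂ (fun a b => a == some b) hf hg
  have := Poly.foldl (l := fun p : List Symbol × List Bool => p.1)
    (init := fun p => ((.width, p.2, 0, 0, true, p.2) : ReadState))
    (f := fun _ => readStep) (by fun_prop) (by fun_prop) (fun a => by
      refine Poly.comp (g := fun s : ReadState => readSymbol a s.1 s.2) ?_ Poly.snd
      refine Poly.cases (f := fun m (s : ReadState) => readSymbol a m s.2) Poly.fst fun m => ?_
      refine Poly.comp (g := fun s => readSymbol a m s) ?_ Poly.snd
      cases m <;> cases a <;> simp only [readSymbol] <;> fun_prop (disch := skip))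
    -- A symbol increments one counter or appends one wire value, or else adds nothing.
    1 (fun _ s a => by
      rcases s with ⟨m, v, i, j, ok, l⟩
      cases m <;> cases a <;> simp [readSymbol] <;> omega)
  unfold checkFixed
  fun_prop

theorem readSymbol_ticks (n : ℕ) (m : ReadMode) (v : List Bool) (i j : ℕ) (t : Bool × List Bool) :
    (List.replicate n Symbol.tick).foldl readStep
      ((m, v, i, j, t) : ReadState) = (m, v, match m with
        | .width => (i, j, t)
        | .ready | .and₁ | .or₁ | .not₁ => (i + n, j, t)
        | .and₂ | .or₂ => (i, j + n, t)) := by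
  induction n generalizing i j with
  | zero => cases m <;> rfl
  | succ n ih =>
    rw [List.replicate_succ, List.foldl_cons]
    cases m <;> simp [readSymbol, ih, add_assoc, add_comm 1]

theorem readSymbol_gate (g : Gate) (v : List Bool) (t : Bool × List Bool) :
    g.encode.foldl readStep ((.ready, v, 0, 0, t) : ReadState) =
      (.ready, v ++ [g.eval v], 0, 0, t) := by
  cases g <;> simp [Gate.encode, encodeNat, readSymbol, readSymbol_ticks, Gate.eval]

theorem readSymbol_gates (gs : List Gate) (v : List Bool) (t : Bool × List Bool) :
    (gs.flatMap Gate.encode).foldl readStep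
      ((.ready, v, 0, 0, t) : ReadState) =
      (.ready, gs.foldl (fun v g => v ++ [g.eval v]) v, 0, 0, t) := by
  induction gs generalizing v with
  | nil => rfl
  | cons g gs ih => rw [List.flatMap_cons, List.foldl_append, readSymbol_gate, ih, List.foldl_cons]

/-- Comparing with `some` rejects a list `l` that is too short, and the final emptiness test rejects
one that is too long. -/
theorem readSymbol_outputs (os : List ℕ) (v : List Bool) (ok : Bool) (l : List Bool) :
    let s := (os.flatMap encodeNat).foldl readStep
      ((.ready, v, 0, 0, ok, l) : ReadState)
    (s.2.2.2.2.1 && s.2.2.2.2.2.isEmpty) = (ok && decide (os.map (v.getD · false) = l)) := by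
  induction os generalizing ok l with
  | nil => cases l <;> simp
  | cons o os ih =>
    have h : (encodeNat o).foldl readStep
        ((.ready, v, 0, 0, ok, l) : ReadState) =
        (.ready, v, 0, 0, ok && (l.head? == some (v.getD o false)), l.tail) := by
      simp [encodeNat, readSymbol_ticks, readSymbol]
    rw [List.flatMap_cons, List.foldl_append, h]
    refine (ih _ _).trans ?_
    cases l with
    | nil => simp
    | cons b l =>
      rw [Bool.eq_iff_iff]
      simp
      grind

theorem checkFixed_encode (C : Circuit) (w : List Bool) :
    checkFixed C.encode w = decide (C.outputs.map ((C.wires w).getD · false) = w) := by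
  unfold checkFixed Circuit.encode
  have h : (encodeNat C.width).foldl readStep
      ((.width, w, 0, 0, true, w) : ReadState) = (.ready, w, 0, 0, true, w) := by
    simp [encodeNat, readSymbol_ticks, readSymbol]
  rw [List.foldl_append, List.foldl_append, h, readSymbol_gates]
  refine (readSymbol_outputs _ _ _ _).trans ?_
  simp [Circuit.wires]

/-- The list of outputs has the length of the width, so equality with `w` already forces `w` to have
the right length. No separate test of the length is needed. -/
theorem exists_isFixedPt_iff (C : Circuit) (w : List Bool) :
    (∃ v : List.Vector Bool C.width, IsFixedPt C.fn v ∧ v.toList = w) ↔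
      C.outputs.map ((C.wires w).getD · false) = w := by
  constructor
  · rintro ⟨v, hv, rfl⟩
    exact congrArg List.Vector.toList hv
  · intro h
    have hw : w.length = C.width := by rw [← h, List.length_map, C.outputs_length]
    exact ⟨⟨w, hw⟩, Subtype.ext h, rfl⟩

theorem mealy_takeWhile (C : Circuit) :
    mealy (fun (q : Bool) (a : Symbol) => match q, a with
      | true, .tick => (true, some ())
      | _, _ => (false, none)) (fun _ => none) true C.encode = unaryEnc C.width := by
  have h₁ (l : List Symbol) : mealy (fun (q : Bool) (a : Symbol) => match q, a with
      | true, .tick => (true, some ())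
      | _, _ => (false, none)) (fun _ => none) false l = [] := by
    induction l with
    | nil => rfl
    | cons a l ih => simpa [mealy] using ih
  have h₂ (n : ℕ) (l : List Symbol) : mealy (fun (q : Bool) (a : Symbol) => match q, a with
      | true, .tick => (true, some ())
      | _, _ => (false, none)) (fun _ => none) true
        (List.replicate n .tick ++ .sep :: l) = unaryEnc n := by
    induction n with
    | zero => exact h₁ l
    | succ n ih =>
      rw [List.replicate_succ, List.cons_append, mealy, ih]
      rfl
  simpa [Circuit.encode, encodeNat] using h₂ C.width _

theorem Algorithm.poly_encode (𝒜 : Algorithm) :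
    Poly (fun x : List Bool => (𝒜.circuit x).encode) :=
  PolyTime.congr (eb' := fun l : List Symbol => l) 𝒜.polyTime fun _ => rfl

theorem Algorithm.poly_width (𝒜 : Algorithm) : Poly (fun x : List Bool => (𝒜.circuit x).width) :=
  (Poly.mealyList (Q := Bool) (fun (q : Bool) (a : Symbol) => match q, a with
      | true, .tick => (true, some ())
      | _, _ => (false, none)) (fun _ => none) true 𝒜.poly_encode).congr
    fun x => (mealy_takeWhile (𝒜.circuit x)).symm

theorem polyTime_encodeUnary_iff {l : List Bool → ℕ} :
    PolyTime (fun x : List Bool => x) encodeUnary l ↔ Poly l := by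
  constructor
  · intro h
    have : Poly (fun x : List Bool => List.replicate (l x) true) := h.congr fun _ => rfl
    simpa using this.length
  · intro h
    exact PolyTime.congr (h.replicate true) fun _ => rfl

open Classical in
-- The encoding with a separator and the encoding by tagged letters are translated into each other:
-- the separator tells a two-state transducer when to change the tag.
theorem polynomiallyDecidable_iff {R : Set (List Bool × List Bool)} :
    PolynomiallyDecidable R ↔ Poly (fun p : List Bool × List Bool => decide (p ∈ R)) := by
  constructor
  · intro h
    have : Poly encodePair :=
      (Poly.fst.map some).append ((Poly.const none).cons (Poly.snd.map some))
    exact PolyTime.comp (eb := encodePair) (f := fun p => p) h (this.congr fun _ => rfl)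
  · intro h
    refine PolyTime.comp (eb := Coded.enc) (f := fun p : List Bool × List Bool => p) h ?_
    refine PolyTime.mealy (Q := Bool) (fun q o => o.elim (true, none) fun b =>
      (q, some (if q then .inr b else .inl b))) (fun _ => none) false ?_
    rintro ⟨x, y⟩
    have h₁ (y : List Bool) : mealy (Q := Bool) (fun q o => o.elim (true, none) fun b =>
        (q, some (if q then Sum.inr b else Sum.inl b))) (fun _ => none) true (y.map some) =
        y.map .inr := by
      induction y with
      | nil => rfl
      | cons b y ih => simpa [mealy] using ih
    have h₂ : mealy (Q := Bool) (fun q o => o.elim (true, none) fun b =>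
        (q, some (if q then Sum.inr b else Sum.inl b))) (fun _ => none) false
          (x.map some ++ none :: y.map some) = x.map .inl ++ y.map .inr := by
      induction x with
      | nil => simpa [mealy] using h₁ y
      | cons b x ih => simpa [mealy] using ih
    exact h₂.symm

end NCCirc

/-! ### From machines to one-dimensional automata -/

namespace NCCirc

open Turing Turing.TM2 Function

section Micro

variable {K : Type} [DecidableEq K] {Γ : K → Type} {Λ σ : Type} (m : Λ → Stmt Γ Λ σ)

/-- Execute a single instruction. -/
def microStep : Stmt Γ Λ σ × σ × (∀ k, List (Γ k)) → Stmt Γ Λ σ × σ × (∀ k, List (Γ k))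
  | (.push k f q, v, S) => (q, v, update S k (f v :: S k))
  | (.peek k f q, v, S) => (q, f v (S k).head?, S)
  | (.pop k f q, v, S) => (q, f v (S k).head?, update S k (S k).tail)
  | (.load f q, v, S) => (q, f v, S)
  | (.branch f q₁ q₂, v, S) => (cond (f v) q₁ q₂, v, S)
  | (.goto f, v, S) => (m (f v), v, S)
  | (.halt, v, S) => (.halt, v, S)

/-- A configuration with the statement to be executed in place of its label. -/
def microCfg (c : Cfg Γ Λ σ) : Stmt Γ Λ σ × σ × (∀ k, List (Γ k)) :=
  (c.l.elim .halt m, c.var, c.stk)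

theorem exists_microStep_stepAux (q : Stmt Γ Λ σ) (v : σ) (S : ∀ k, List (Γ k)) :
    ∃ n ≤ stmtSize q, (microStep m)^[n] (q, v, S) = microCfg m (stepAux q v S) := by
  induction q generalizing v S with
  | push _ _ _ ih | peek _ _ _ ih | pop _ _ _ ih | load _ _ ih =>
    obtain ⟨n, hn, h⟩ := ih _ _
    exact ⟨n + 1, Nat.succ_le_succ hn, h⟩
  | branch f q₁ q₂ ih₁ ih₂ =>
    cases hf : f v
    · obtain ⟨n, hn, h⟩ := ih₂ v S
      refine ⟨n + 1, by simp only [stmtSize]; omega, ?_⟩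
      simpa [iterate_succ_apply, microStep, hf] using h
    · obtain ⟨n, hn, h⟩ := ih₁ v S
      refine ⟨n + 1, by simp only [stmtSize]; omega, ?_⟩
      simpa [iterate_succ_apply, microStep, hf] using h
  | goto f => exact ⟨1, le_rfl, rfl⟩
  | halt => exact ⟨0, Nat.zero_le _, rfl⟩

theorem Steps.exists_microStep {C : ℕ} (hC : ∀ l, stmtSize (m l) ≤ C) {n c c'}
    (h : Steps m n c c') :
    ∃ n' ≤ n * C, (microStep m)^[n'] (microCfg m c) = microCfg m c' := by
  induction h with
  | refl => exact ⟨0, Nat.zero_le _, rfl⟩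
  | @head n l v S c' _ ih =>
    obtain ⟨n₁, hn₁, h₁⟩ := exists_microStep_stepAux m (m l) v S
    obtain ⟨n₂, hn₂, h₂⟩ := ih
    refine ⟨n₂ + n₁, ?_, ?_⟩
    · have := hC l
      rw [add_mul]
      omega
    · rw [iterate_add_apply, ← h₂, ← h₁]
      rfl

/-- A halted configuration is fixed by further instructions, so the result may be read off at any
sufficiently late time. A circuit simulates a prescribed number of instructions and depends on this.
-/
theorem Steps.microStep_of_le {C : ℕ} (hC : ∀ l, stmtSize (m l) ≤ C) {n c c'}
    (h : Steps m n c c') (hc' : c'.l = none) {N : ℕ} (hN : n * C ≤ N) :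
    (microStep m)^[N] (microCfg m c) = microCfg m c' := by
  obtain ⟨n', hn', h'⟩ := h.exists_microStep m hC
  obtain ⟨d, rfl⟩ := Nat.exists_eq_add_of_le (hn'.trans hN)
  rw [add_comm, iterate_add_apply, h']
  have : IsFixedPt (microStep m) (microCfg m c') := by
    rcases c' with ⟨l, v, S⟩
    cases hc'
    rfl
  exact this.iterate d

variable (Γ Λ σ) in
/-- The symbols at the same depth in all stacks; those at the top are accompanied by the control
information. -/
abbrev Cell := Option (Stmt Γ Λ σ × σ) × (∀ k, Option (Γ k))

/-- The content of cell number `i`. -/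
def cellOf (c : Stmt Γ Λ σ × σ × (∀ k, List (Γ k))) (i : ℕ) : Cell Γ Λ σ :=
  (if i = 0 then some (c.1, c.2.1) else none, fun k => (c.2.2 k)[i]?)

/-- The next content of a cell, given the contents of the top cell, of the cell above, of the cell
itself and of the cell below. -/
def cellRule (top above self below : Cell Γ Λ σ) : Cell Γ Λ σ :=
  match top.1 with
  | none => self
  | some (.push k f q, v) =>
    (self.1.map fun _ => (q, v), update self.2 k (self.1.elim (above.2 k) fun _ => some (f v)))
  | some (.peek k f q, v) => (self.1.map fun _ => (q, f v (top.2 k)), self.2)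
  | some (.pop k f q, v) => (self.1.map fun _ => (q, f v (top.2 k)), update self.2 k (below.2 k))
  | some (.load f q, v) => (self.1.map fun _ => (q, f v), self.2)
  | some (.branch f q₁ q₂, v) => (self.1.map fun _ => (cond (f v) q₁ q₂, v), self.2)
  | some (.goto f, v) => (self.1.map fun _ => (m (f v), v), self.2)
  | some (.halt, v) => (self.1.map fun _ => (.halt, v), self.2)

/-- Instructions act at the tops of stacks: a push shifts a stack down by one cell, a pop shifts it
up, and all control information is in cell 0. The truncated `i - 1` is harmless for `i = 0`, since
the top cell takes the pushed symbol and does not consult the cell above. -/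
theorem cellOf_microStep (c : Stmt Γ Λ σ × σ × (∀ k, List (Γ k))) (i : ℕ) :
    cellOf (microStep m c) i =
      cellRule m (cellOf c 0) (cellOf c (i - 1)) (cellOf c i) (cellOf c (i + 1)) := by
  obtain ⟨q, v, S⟩ := c
  have hif (a b : Stmt Γ Λ σ × σ) : (if i = 0 then some a else none) =
      (if i = 0 then some b else none).map fun _ => a := by split_ifs <;> rfl
  cases q <;> simp only [cellOf, microStep, cellRule, if_true, List.head?_eq_getElem?]
  case push k f q =>
    refine Prod.ext (hif _ _) (funext fun k' => ?_)
    by_cases hk : k' = k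
    · subst hk
      cases i <;> simp
    · simp [hk]
  case pop k f q =>
    refine Prod.ext (hif _ _) (funext fun k' => ?_)
    by_cases hk : k' = k
    · subst hk
      simp
    · simp [hk]
  all_goals exact Prod.ext (hif _ _) rfl

end Micro

/-- The states of the cells of a one-dimensional automaton where each cell sees its neighbours and
cell 0. -/
def automaton {X : Type} (rule : X → X → X → X → X) (init : ℕ → X) : ℕ → ℕ → X
  | 0, i => init i
  | t + 1, i => rule (automaton rule init t 0) (automaton rule init t (i - 1))
      (automaton rule init t i) (automaton rule init t (i + 1))

section Finiteness

variable {K : Type} [DecidableEq K] {Γ : K → Type} {Λ σ : Type} (m : Λ → Stmt Γ Λ σ)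

/-- The statements of a program. -/
def progStmts : Set (Stmt Γ Λ σ) := {q | q = .halt ∨ ∃ l, q ∈ stmts₁ (m l)}

/-- The symbols that a program pushes on a stack. -/
def pushed (k : K) : Set (Option (Γ k)) :=
  (fun p : Stmt Γ Λ σ × σ => ((microStep m (p.1, p.2, fun _ => [])).2.2 k).head?) ''
    (progStmts m ×ˢ Set.univ)

/-- The possible contents of cells. -/
def possibleCells (I : ∀ k, Set (Option (Γ k))) : Set (Cell Γ Λ σ) :=
  (insert none (some '' (progStmts m ×ˢ Set.univ))) ×ˢ {s | ∀ k, s k ∈ pushed m k ∪ I k}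

/-- Neither the type of statements nor the stack alphabets have to be finite. But a program has
finitely many substatements, and a push instruction computes its symbol from one of finitely many
states, so only finitely many symbols occur besides the initial ones in `I`. -/
theorem finite_possibleCells [Finite K] [Finite Λ] [Finite σ] {I : ∀ k, Set (Option (Γ k))}
    (hI : ∀ k, (I k).Finite) : (possibleCells m I).Finite := by
  have h : (progStmts m).Finite := by
    have : progStmts m = {.halt} ∪ ⋃ l, ↑(stmts₁ (m l)) := by
      ext q; simp [progStmts]
    rw [this]
    exact (Set.finite_singleton _).union (Set.finite_iUnion fun l => Finset.finite_toSet _)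
  have h' : (progStmts m ×ˢ (Set.univ : Set σ)).Finite := h.prod Set.finite_univ
  refine ((h'.image _).insert _).prod ?_
  exact Set.Finite.pi' fun k => (h'.image _).union (hI k)

/-- A new statement in a cell is a substatement of an old one, the start of a labelled statement or
`halt`; a new symbol is pushed or comes from a neighbour. Hence the rule restricts to a finite set
of states. -/
theorem cellRule_mem {I : ∀ k, Set (Option (Γ k))} {a b c d : Cell Γ Λ σ}
    (ha : a ∈ possibleCells m I) (hb : b ∈ possibleCells m I) (hc : c ∈ possibleCells m I)
    (hd : d ∈ possibleCells m I) : cellRule m a b c d ∈ possibleCells m I := by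
  obtain ⟨ha, -⟩ := ha
  have hmap (q : Stmt Γ Λ σ) (v : σ) (hq : q ∈ progStmts m) :
      (c.1.map fun _ => (q, v)) ∈ insert none (some '' (progStmts m ×ˢ (Set.univ : Set σ))) := by
    cases c.1
    · exact .inl rfl
    · exact .inr ⟨_, ⟨hq, trivial⟩, rfl⟩
  have hupd (k : K) (o : Option (Γ k)) (ho : o ∈ pushed m k ∪ I k) :
      update c.2 k o ∈ {s : ∀ k, Option (Γ k) | ∀ k, s k ∈ pushed m k ∪ I k} := by
    intro k'
    by_cases hk : k' = k
    · subst hk; simpa using ho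
    · simpa [hk] using hc.2 k'
  have hsub {q q' : Stmt Γ Λ σ} (h : q ∈ progStmts m) (hq : q ≠ .halt) (h' : q' ∈ stmts₁ q) :
      q' ∈ progStmts m := by
    obtain h | ⟨l, hl⟩ := h
    · exact absurd h hq
    · exact .inr ⟨l, stmts₁_trans hl h'⟩
  rcases a with ⟨_ | ⟨q, v⟩, s⟩
  · exact hc
  obtain h | ⟨_, ⟨hq, -⟩, h⟩ := ha
  · cases h
  cases h
  cases q with
  | push k f q =>
    refine ⟨hmap _ _ (hsub hq (by simp) (by simp [stmts₁, stmts₁_self])), hupd _ _ ?_⟩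
    cases c.1
    · exact hb.2 k
    · refine .inl ⟨(.push k f q, v), ⟨hq, trivial⟩, ?_⟩
      simp [microStep]
  | peek k f q | load f q =>
    exact ⟨hmap _ _ (hsub hq (by simp) (by simp [stmts₁, stmts₁_self])), hc.2⟩
  | pop k f q =>
    exact ⟨hmap _ _ (hsub hq (by simp) (by simp [stmts₁, stmts₁_self])), hupd _ _ (hd.2 k)⟩
  | branch f q₁ q₂ =>
    refine ⟨hmap _ _ (hsub hq (by simp) ?_), hc.2⟩
    cases f v <;> simp [stmts₁, stmts₁_self]
  | goto f => exact ⟨hmap _ _ (.inr ⟨_, stmts₁_self⟩), hc.2⟩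
  | halt => exact ⟨hmap _ _ (.inl rfl), hc.2⟩

end Finiteness

/-- A predicate decidable in polynomial time is decided by a finite one-dimensional automaton, the
answer appearing in cell 0. -/
theorem PolyTime.exists_automaton {α A : Type} [Finite A] {ea : α → List A} {f : α → Bool}
    (h : PolyTime ea Computability.encodeBool f) :
    ∃ (X : Type) (_ : Finite X) (rule : X → X → X → X → X) (init : Bool → Option A → X)
      (acc : X → Bool) (p : Polynomial ℕ), ∀ a, ∀ N ≥ p.eval (ea a).length,
        acc (automaton rule (fun i => init (i == 0) (ea a)[i]?) N 0) = f a := by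
  classical
  obtain ⟨tm, iA, iB, p, h⟩ := h.exists_steps
  have := tm.kFin
  have := tm.ΛFin
  have := tm.σFin
  obtain ⟨C, hC⟩ := (Set.finite_range fun l => stmtSize (tm.m l)).bddAbove
  -- The initial contents of cells: absence of a symbol, and input letters on the input stack.
  let I (k : tm.K) : Set (Option (tm.Γ k)) :=
    Set.range fun o : Option A => (single tm.k₀ (o.toList.map iA.symm) k).head?
  let D := possibleCells tm.m I
  have : Finite D := (finite_possibleCells tm.m fun k => Set.finite_range _).to_subtype
  let rule (a b c d : D) : D := ⟨cellRule tm.m a b c d, cellRule_mem _ a.2 b.2 c.2 d.2⟩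
  let init (b : Bool) (o : Option A) : D :=
    ⟨(if b then some (tm.m tm.main, tm.initialState) else none,
      fun k => (single tm.k₀ (o.toList.map iA.symm) k).head?), by
        cases b
        · exact .inl rfl
        · exact .inr ⟨_, ⟨.inr ⟨_, stmts₁_self⟩, trivial⟩, rfl⟩, fun k => .inr ⟨o, rfl⟩⟩
  -- Acceptance means that `true` is on top of the output stack. The factor `C` bounds the number of
  -- instructions in a step of the machine.
  refine ⟨D, this, rule, init, fun c => decide (c.1.2 tm.k₁ = some (iB.symm true)), p * .C C,
    fun a N hN => ?_⟩
  obtain ⟨n, hn, h⟩ := h a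
  have hrun := h.microStep_of_le tm.m (fun l => hC ⟨l, rfl⟩) rfl (N := N) (by
    rw [Polynomial.eval_mul, Polynomial.eval_C] at hN
    exact (Nat.mul_le_mul_right C hn).trans hN)
  have key (t i : ℕ) : (automaton rule (fun i => init (i == 0) (ea a)[i]?) t i).1 =
      cellOf ((microStep tm.m)^[t] (microCfg tm.m ⟨some tm.main, tm.initialState,
        single tm.k₀ ((ea a).map iA.symm)⟩)) i := by
    induction t generalizing i with
    | zero =>
      refine Prod.ext ?_ (funext fun k => ?_)
      · simp [automaton, init, cellOf, microCfg]
      · simp only [automaton, init, cellOf, microCfg, iterate_zero_apply]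
        by_cases hk : k = tm.k₀
        · subst hk
          simp only [single_self, List.getElem?_map]
          cases (ea a)[i]? <;> rfl
        · simp [single, hk]
    | succ t ih =>
      rw [iterate_succ_apply', cellOf_microStep, ← ih, ← ih, ← ih, ← ih]
      rfl
  beta_reduce
  rw [key, hrun]
  simp only [cellOf, microCfg, single_self, Computability.encodeBool, List.getElem?_map]
  cases f a <;> simp

end NCCirc

/-! ### Boolean formulas and lists of gates -/

namespace NCCirc

open Function

/-- Boolean formulas with variables from `V`. -/
inductive BoolForm (V : Type) where
  | var (x : V)
  | copy (e : BoolForm V)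
  | neg (e : BoolForm V)
  | and (e e' : BoolForm V)
  | or (e e' : BoolForm V)

namespace BoolForm

variable {V : Type}

/-- The value of a formula. -/
def eval (a : V → Bool) : BoolForm V → Bool
  | var x => a x
  | copy e => e.eval a
  | neg e => !e.eval a
  | and e e' => e.eval a && e'.eval a
  | or e e' => e.eval a || e'.eval a

/-- The number of gates needed for a formula. -/
def size : BoolForm V → ℕ
  | var _ => 1
  | copy e | neg e => e.size + 1
  | and e e' | or e e' => e.size + e'.size + 1

theorem size_pos (e : BoolForm V) : 0 < e.size := by cases e <;> simp [size]

/-- Case distinction on one variable after another: `f` is `x` and `f` with `x` true, or not `x` and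
`f` with `x` false. The variable `x₀` serves to express constants, as there are no constant gates.
-/
theorem exists_of_list [DecidableEq V] (x₀ : V) (l : List V) (f : (V → Bool) → Bool)
    (hf : ∀ a b, (∀ x ∈ l, a x = b x) → f a = f b) : ∃ e : BoolForm V, ∀ a, e.eval a = f a := by
  induction l generalizing f with
  | nil =>
    cases h : f fun _ => false
    · exact ⟨.and (.var x₀) (.neg (.var x₀)), fun a => by
        rw [hf a (fun _ => false) (by simp), h]; simp [eval]⟩
    · exact ⟨.or (.var x₀) (.neg (.var x₀)), fun a => by
        rw [hf a (fun _ => false) (by simp), h]; simp [eval]⟩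
  | cons x l ih =>
    have key (c : Bool) : ∃ e : BoolForm V, ∀ a, e.eval a = f (update a x c) := by
      refine ih (fun a => f (update a x c)) fun a b hab => hf _ _ fun y hy => ?_
      by_cases hyx : y = x
      · subst hyx; simp
      · simpa [hyx] using hab y ((List.mem_cons.1 hy).resolve_left hyx)
    obtain ⟨e₀, h₀⟩ := key false
    obtain ⟨e₁, h₁⟩ := key true
    refine ⟨.or (.and (.var x) e₁) (.and (.neg (.var x)) e₀), fun a => ?_⟩
    have ha := update_eq_self x a
    cases hx : a x <;> rw [hx] at ha <;> simp [eval, h₀, h₁, hx, ha]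

theorem exists_eval_eq [Finite V] [Nonempty V] (f : (V → Bool) → Bool) :
    ∃ e : BoolForm V, ∀ a, e.eval a = f a := by
  classical
  have := Fintype.ofFinite V
  exact exists_of_list (Classical.arbitrary V) Finset.univ.toList f fun a b h =>
    congrArg f (funext fun x => h x (by simp))

/-- Copying gates enlarge a formula without changing its value. With all formulas of one size,
numbers of wires in the tableau become products and sums. -/
theorem exists_size_eq [Finite V] [Nonempty V] (f : (V → Bool) → Bool) :
    ∃ s, ∀ M ≥ s, ∃ e : BoolForm V, e.size = M ∧ ∀ a, e.eval a = f a := by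
  obtain ⟨e, he⟩ := exists_eval_eq f
  refine ⟨e.size, fun M hM => ?_⟩
  induction M, hM using Nat.le_induction with
  | base => exact ⟨e, rfl, he⟩
  | succ M _ ih =>
    obtain ⟨e', hsize, heval⟩ := ih
    exact ⟨e'.copy, by simp [size, hsize], heval⟩

/-- Finitely many Boolean functions have formulas of the same size, which can be chosen arbitrarily
large. -/
theorem exists_family_size_eq {ι : Type} [Finite ι] [Finite V] [Nonempty V]
    (f : ι → (V → Bool) → Bool) :
    ∃ s, ∀ M ≥ s, ∃ e : ι → BoolForm V, ∀ i, (e i).size = M ∧ ∀ a, (e i).eval a = f i a := by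
  choose s hs using fun i => exists_size_eq (f i)
  obtain ⟨B, hB⟩ := (Set.finite_range s).bddAbove
  refine ⟨B, fun M hM => ?_⟩
  choose e he using fun i => hs i M ((hB ⟨i, rfl⟩).trans hM)
  exact ⟨e, he⟩

/-- Gates that compute the value of a formula, numbered from `base` on, where variable `x` is the
wire `ρ x`. The value is that of the last gate. -/
def gates (ρ : V → ℕ) : BoolForm V → ℕ → List Gate
  | var x, _ => [.andGate (ρ x) (ρ x)]
  | copy e, base => e.gates ρ base ++ [.andGate (base + e.size - 1) (base + e.size - 1)]
  | neg e, base => e.gates ρ base ++ [.notGate (base + e.size - 1)]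
  | and e e', base => e.gates ρ base ++ (e'.gates ρ (base + e.size) ++
      [.andGate (base + e.size - 1) (base + e.size + e'.size - 1)])
  | or e e', base => e.gates ρ base ++ (e'.gates ρ (base + e.size) ++
      [.orGate (base + e.size - 1) (base + e.size + e'.size - 1)])

@[simp] theorem length_gates (ρ : V → ℕ) (e : BoolForm V) (base : ℕ) :
    (e.gates ρ base).length = e.size := by
  induction e generalizing base <;> simp_all [gates, size, add_assoc]

end BoolForm

/-- Each gate in a list satisfies `P` together with its number, where numbers start from `base`. -/
def AllAt (P : ℕ → Gate → Prop) : ℕ → List Gate → Prop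
  | _, [] => True
  | base, g :: gs => P base g ∧ AllAt P (base + 1) gs

section AllAt

variable {P : ℕ → Gate → Prop} {base : ℕ}

@[simp] theorem allAt_nil : AllAt P base [] := trivial

@[simp] theorem allAt_cons {g : Gate} {gs : List Gate} :
    AllAt P base (g :: gs) ↔ P base g ∧ AllAt P (base + 1) gs := Iff.rfl

theorem allAt_append {gs gs' : List Gate} :
    AllAt P base (gs ++ gs') ↔ AllAt P base gs ∧ AllAt P (base + gs.length) gs' := by
  induction gs generalizing base with
  | nil => simp
  | cons g gs ih => simp [ih, and_assoc, add_assoc, add_comm 1]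

theorem AllAt.get {gs : List Gate} (h : AllAt P base gs) (k : ℕ) (hk : k < gs.length) :
    P (base + k) gs[k] := by
  induction gs generalizing base k with
  | nil => simp at hk
  | cons g gs ih =>
    cases k with
    | zero => exact h.1
    | succ k =>
      have := ih h.2 k (by simpa using hk)
      rwa [add_assoc, add_comm 1] at this

/-- Since all blocks have the same length, block `k` starts at `base + k * len`. -/
theorem allAt_flatMap {ι : Type} {l : List ι} {G : ι → List Gate} {len : ℕ}
    (hG : ∀ i, (G i).length = len) :
    AllAt P base (l.flatMap G) ↔ ∀ k (hk : k < l.length), AllAt P (base + k * len) (G l[k]) := by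
  induction l generalizing base with
  | nil => simp
  | cons i l ih =>
    rw [List.flatMap_cons, allAt_append, ih, hG]
    constructor
    · rintro ⟨h, h'⟩ k hk
      cases k with
      | zero => simpa using h
      | succ k =>
        have := h' k (by simpa using hk)
        rwa [add_assoc, add_comm len, ← Nat.succ_mul] at this
    · intro h
      refine ⟨?_, fun k hk => ?_⟩
      · have := h 0 (by simp)
        rwa [Nat.zero_mul, Nat.add_zero, List.getElem_cons_zero] at this
      · have := h (k + 1) (by simpa using hk)
        rwa [Nat.succ_mul, add_comm (k * len), ← add_assoc] at this

theorem allAt_flatMap_range {n : ℕ} {G : ℕ → List Gate} {len : ℕ} (hG : ∀ i, (G i).length = len) :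
    AllAt P base ((List.range n).flatMap G) ↔ ∀ i < n, AllAt P (base + i * len) (G i) := by
  simp [allAt_flatMap hG]

theorem allAt_flatMap_finRange {n : ℕ} {G : Fin n → List Gate} {len : ℕ}
    (hG : ∀ i, (G i).length = len) :
    AllAt P base ((List.finRange n).flatMap G) ↔ ∀ i : Fin n, AllAt P (base + i * len) (G i) := by
  simp [allAt_flatMap hG, Fin.forall_iff]

end AllAt

/-- The output of a gate, given the values of all wires. -/
def Gate.value (val : ℕ → Bool) : Gate → Bool
  | andGate i j => val i && val j
  | orGate i j => val i || val j
  | notGate i => !val i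

/-- Values of wires that are in accordance with the gates. -/
abbrev Computes (val : ℕ → Bool) : ℕ → List Gate → Prop := AllAt fun k g => val k = g.value val

/-- Gates that only read wires with smaller numbers. -/
abbrev Acyclic : ℕ → List Gate → Prop := AllAt fun k g => g.ReadsBelow k

theorem BoolForm.acyclic_gates {V : Type} {ρ : V → ℕ} (e : BoolForm V) {base : ℕ}
    (hρ : ∀ x, ρ x < base) : Acyclic base (e.gates ρ base) := by
  induction e generalizing base with
  | var x => exact ⟨⟨hρ x, hρ x⟩, trivial⟩
  | copy e ih | neg e ih =>
    have := e.size_pos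
    rw [gates, Acyclic, allAt_append]
    refine ⟨ih hρ, ?_⟩
    simp [Gate.ReadsBelow]
    omega
  | and e e' ih ih' | or e e' ih ih' =>
    have := e.size_pos
    have := e'.size_pos
    rw [gates, Acyclic, allAt_append, allAt_append]
    refine ⟨ih hρ, ?_, ?_⟩
    · simpa using ih' fun x => (hρ x).trans_le (Nat.le_add_right _ _)
    · simp [Gate.ReadsBelow]
      omega

theorem BoolForm.value_of_computes {V : Type} {ρ : V → ℕ} (e : BoolForm V) {base : ℕ}
    {val : ℕ → Bool} (h : Computes val base (e.gates ρ base)) :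
    val (base + e.size - 1) = e.eval fun x => val (ρ x) := by
  induction e generalizing base with
  | var x => simpa [gates, Gate.value, eval, size] using h
  | copy e ih | neg e ih =>
    rw [gates, Computes, allAt_append] at h
    have h' := h.2
    simp only [length_gates, allAt_cons, Gate.value, ih h.1, Bool.and_self] at h'
    simpa [size, eval, ← add_assoc] using h'.1
  | and e e' ih ih' | or e e' ih ih' =>
    rw [gates, Computes, allAt_append, allAt_append, length_gates] at h
    have h' := h.2.2
    simp only [length_gates, allAt_cons, Gate.value, ih h.1, ih' h.2.1] at h'
    simpa [size, eval, ← add_assoc] using h'.1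

/-- Appending values never changes earlier ones, and gates read only earlier wires. So the final
list satisfies all gate equations simultaneously, and the order of evaluation can be forgotten from
here on. -/
theorem wires_computes (gs : List Gate) (v : List Bool) (h : Acyclic v.length gs) :
    let W := gs.foldl (fun v g => v ++ [g.eval v]) v
    v <+: W ∧ Computes (W.getD · false) v.length gs := by
  induction gs generalizing v with
  | nil => exact ⟨List.prefix_rfl, trivial⟩
  | cons g gs ih =>
    have hlen : (v ++ [g.eval v]).length = v.length + 1 := by simp
    obtain ⟨h₁, h₂⟩ := ih (v ++ [g.eval v]) (by rw [hlen]; exact h.2)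
    rw [hlen] at h₂
    refine ⟨(List.prefix_append _ _).trans h₁, ?_, h₂⟩
    rw [List.foldl_cons]
    generalize gs.foldl (fun v g => v ++ [g.eval v]) (v ++ [g.eval v]) = W at h₁
    obtain ⟨u, rfl⟩ := h₁
    have hv (b : Bool) {i : ℕ} (hi : i < v.length) :
        (v ++ [b] ++ u).getD i false = v.getD i false := by
      rw [List.append_assoc, List.getD_append _ _ _ _ hi]
    have hr := h.1
    have : (v ++ [g.eval v] ++ u).getD v.length false = g.eval v := by simp
    beta_reduce
    rw [this]
    cases g <;> simp only [Gate.ReadsBelow] at hr <;> simp only [Gate.eval, Gate.value]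
    · rw [hv _ hr.1, hv _ hr.2]
    · rw [hv _ hr.1, hv _ hr.2]
    · rw [hv _ hr]

/-! Descriptions of gates in polynomial time -/

section PolyGates

variable {ε : Type} [Coded ε]

/-- The descriptions of the gates are computable in polynomial time. -/
def PolyGates (G : ε → List Gate) : Prop := Poly (fun e => (G e).flatMap Gate.encode)

theorem Poly.encodeNat {f : ε → ℕ} (hf : Poly f) : Poly (fun e => encodeNat (f e)) := by
  unfold NCCirc.encodeNat
  fun_prop

theorem PolyGates.nil : PolyGates (fun _ : ε => []) := Poly.const _

theorem PolyGates.append {G H : ε → List Gate} (hG : PolyGates G) (hH : PolyGates H) :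
    PolyGates (fun e => G e ++ H e) := by
  simpa only [PolyGates, List.flatMap_append] using Poly.append hG hH

theorem PolyGates.andGate {f g : ε → ℕ} (hf : Poly f) (hg : Poly g) :
    PolyGates (fun e => [.andGate (f e) (g e)]) := by
  simpa [PolyGates, Gate.encode] using
    (Poly.const (α := ε) Symbol.andSym).cons (hf.encodeNat.append hg.encodeNat)

theorem PolyGates.orGate {f g : ε → ℕ} (hf : Poly f) (hg : Poly g) :
    PolyGates (fun e => [.orGate (f e) (g e)]) := by
  simpa [PolyGates, Gate.encode] using
    (Poly.const (α := ε) Symbol.orSym).cons (hf.encodeNat.append hg.encodeNat)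

theorem PolyGates.notGate {f : ε → ℕ} (hf : Poly f) : PolyGates (fun e => [.notGate (f e)]) := by
  simpa [PolyGates, Gate.encode] using (Poly.const (α := ε) Symbol.notSym).cons hf.encodeNat

theorem PolyGates.form {V : Type} (e : BoolForm V) {ρ : ε → V → ℕ} {base : ε → ℕ}
    (hρ : ∀ x, Poly (fun a => ρ a x)) (hb : Poly base) :
    PolyGates (fun a => e.gates (ρ a) (base a)) := by
  induction e generalizing base with
  | var x => exact .andGate (hρ x) (hρ x)
  | copy e ih => exact (ih hb).append (.andGate (by fun_prop) (by fun_prop))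
  | neg e ih => exact (ih hb).append (.notGate (by fun_prop))
  | and e e' ih ih' =>
    exact (ih hb).append ((ih' (by fun_prop)).append (.andGate (by fun_prop) (by fun_prop)))
  | or e e' ih ih' =>
    exact (ih hb).append ((ih' (by fun_prop)).append (.orGate (by fun_prop) (by fun_prop)))

theorem PolyGates.flatMap_list {ι : Type} (l : List ι) {G : ε → ι → List Gate}
    (hG : ∀ i, PolyGates (fun e => G e i)) : PolyGates (fun e => l.flatMap (G e)) := by
  induction l with
  | nil => exact .nil
  | cons i l ih => exact (hG i).append ih

theorem PolyGates.flatMap_range {n : ε → ℕ} {G : ε → ℕ → List Gate} (hn : Poly n)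
    (hG : PolyGates (fun p : ε × ℕ => G p.1 p.2)) :
    PolyGates (fun e => (List.range (n e)).flatMap (G e)) := by
  simpa only [PolyGates, List.flatMap_assoc] using
    Poly.flatMap_range (f := fun e i => (G e i).flatMap Gate.encode) hn hG

end PolyGates

theorem Poly.min {ε : Type} [Coded ε] {f g : ε → ℕ} (hf : Poly f) (hg : Poly g) :
    Poly (fun e => min (f e) (g e)) := by
  have : Poly (fun e => f e - (f e - g e)) := by fun_prop
  exact this.congr fun e => congrArg _ (by omega)

end NCCirc

/-! ### The circuit that tests its own input -/

namespace NCCirc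

open Function

/-- Where the letter in a cell of the initial configuration comes from: `none` for no letter,
`some none` for a bit of the input of the circuit, `some (some o)` for the letter `o`. -/
abbrev Source := Option (Option (Option Bool))

/-- The letter, given the bit of the input. -/
def Source.letter (k : Source) (u : Bool) : Option (Option Bool) := k.map fun o => o.getD (some u)

/-- The source of letter number `i` of `encodePair (x, y)`, where `y` has length `n`. -/
def source (x : List Bool) (n i : ℕ) : Source :=
  (x.map some ++ [none])[i]?.elim (cond (decide (i < x.length + 1 + n)) (some none) none)
    fun o => some (some o)

/-- The bit of `y` matters only for positions after the separator and within `y`, where the minimum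
is the position in `y`. Elsewhere the truncated difference and the minimum merely keep the wire
number among the inputs. -/
theorem letter_source (x y : List Bool) (i : ℕ) :
    (source x y.length i).letter (y.getD (min (i - (x.length + 1)) (y.length - 1)) false) =
      (encodePair (x, y))[i]? := by
  have h : encodePair (x, y) = (x.map some ++ [none]) ++ y.map some := by simp [encodePair]
  have hlen : (x.map some ++ [none]).length = x.length + 1 := by simp
  rw [h, source]
  generalize x.map some ++ [none] = l at hlen
  rcases lt_or_ge i (x.length + 1) with hi | hi
  · rw [List.getElem?_append_left (by rwa [hlen]), List.getElem?_eq_getElem (by rwa [hlen])]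
    rfl
  · rw [List.getElem?_append_right (by rwa [hlen]), List.getElem?_eq_none (by rwa [hlen]), hlen]
    rcases lt_or_ge i (x.length + 1 + y.length) with hi' | hi'
    · have : i - (x.length + 1) < y.length := by omega
      rw [min_eq_left (by omega)]
      simp [Source.letter, hi', this]
    · rw [List.getElem?_eq_none (by rw [List.length_map]; omega)]
      simp [Source.letter, decide_eq_false hi'.not_gt]

/-- Formulas for simulating an automaton whose states are described by `b` bits. The formulas for
the bits all have size `M`. -/
structure Simulator where
  b : ℕ
  M : ℕ
  step : Fin b → BoolForm (Fin 4 × Fin b)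
  start : Bool → Source → Fin b → BoolForm Unit
  final : BoolForm (Option (Fin b))
  size_step : ∀ j, (step j).size = M
  size_start : ∀ c k j, (start c k j).size = M

namespace Simulator

variable (τ : Simulator)

/-- The number of gates for a step of `S` cells. -/
def rowSize (S : ℕ) : ℕ := S * (τ.b * τ.M)

/-- The wire of bit `j` of cell `i` after `t` steps. -/
def addr (n S t i : ℕ) (j : Fin τ.b) : ℕ :=
  n + t * τ.rowSize S + i * (τ.b * τ.M) + j * τ.M + τ.M - 1

/-- Gates for the bits of a cell. -/
def cellGates {V : Type} (e : Fin τ.b → BoolForm V) (ρ : V → ℕ) (base : ℕ) : List Gate :=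
  (List.finRange τ.b).flatMap fun j => (e j).gates ρ (base + j * τ.M)

/-- Gates for the initial configuration. -/
def startGates (x : List Bool) (n S : ℕ) : List Gate :=
  (List.range S).flatMap fun i => τ.cellGates (τ.start (i == 0) (source x n i))
    (fun _ => min (i - (x.length + 1)) (n - 1)) (n + i * (τ.b * τ.M))

/-- The wire that is read as variable `v` by the formulas for cell `i` in step `t`. -/
def neighbour (n S t i : ℕ) (v : Fin 4 × Fin τ.b) : ℕ :=
  τ.addr n S t (![0, i - 1, i, min (i + 1) (S - 1)] v.1) v.2

/-- Gates for `T` steps. -/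
def stepGates (n S T : ℕ) : List Gate :=
  (List.range T).flatMap fun t => (List.range S).flatMap fun i =>
    τ.cellGates τ.step (τ.neighbour n S t i)
      (n + τ.rowSize S + t * τ.rowSize S + i * (τ.b * τ.M))

/-- Gates for simulating `T` steps on `T + 1` cells and computing the final formula. -/
def gates (x : List Bool) (n T : ℕ) : List Gate :=
  τ.startGates x n (T + 1) ++ (τ.stepGates n (T + 1) T ++
    τ.final.gates (Option.elim · 0 (τ.addr n (T + 1) T 0))
      (n + τ.rowSize (T + 1) + T * τ.rowSize (T + 1)))

/-- The wire with the value of the final formula. -/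
def finalWire (n T : ℕ) : ℕ :=
  n + τ.rowSize (T + 1) + T * τ.rowSize (T + 1) + τ.final.size - 1

variable {τ}

theorem length_cellGates {V : Type} {e : Fin τ.b → BoolForm V} (he : ∀ j, (e j).size = τ.M)
    (ρ : V → ℕ) (base : ℕ) : (τ.cellGates e ρ base).length = τ.b * τ.M := by
  simp [cellGates, he]

theorem length_startGates (x : List Bool) (n S : ℕ) :
    (τ.startGates x n S).length = τ.rowSize S := by
  simp [startGates, length_cellGates (τ.size_start _ _), rowSize]

theorem length_stepGates (n S T : ℕ) : (τ.stepGates n S T).length = T * τ.rowSize S := by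
  simp [stepGates, length_cellGates τ.size_step, rowSize]

theorem allAt_gates {P : ℕ → Gate → Prop} {x : List Bool} {n T : ℕ} :
    AllAt P n (τ.gates x n T) ↔
      (∀ i < T + 1, ∀ j : Fin τ.b, AllAt P (n + i * (τ.b * τ.M) + j * τ.M)
        ((τ.start (i == 0) (source x n i) j).gates
          (fun _ => min (i - (x.length + 1)) (n - 1)) (n + i * (τ.b * τ.M) + j * τ.M))) ∧
      (∀ t < T, ∀ i < T + 1, ∀ j : Fin τ.b, AllAt P
        (n + τ.rowSize (T + 1) + t * τ.rowSize (T + 1) + i * (τ.b * τ.M) + j * τ.M)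
        ((τ.step j).gates (τ.neighbour n (T + 1) t i)
          (n + τ.rowSize (T + 1) + t * τ.rowSize (T + 1) + i * (τ.b * τ.M) + j * τ.M))) ∧
      AllAt P (n + τ.rowSize (T + 1) + T * τ.rowSize (T + 1))
        (τ.final.gates (Option.elim · 0 (τ.addr n (T + 1) T 0))
          (n + τ.rowSize (T + 1) + T * τ.rowSize (T + 1))) := by
  rw [gates, allAt_append, allAt_append, length_startGates, length_stepGates, startGates,
    stepGates, allAt_flatMap_range fun i => length_cellGates (τ.size_start _ _) _ _,
    allAt_flatMap_range (len := τ.rowSize (T + 1)) fun t => by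
      simp [length_cellGates τ.size_step, rowSize]]
  refine and_congr (forall₂_congr fun i _ => ?_) (and_congr_left' (forall₂_congr fun t _ => ?_))
  · rw [cellGates, allAt_flatMap_finRange fun j => by
      rw [BoolForm.length_gates]; exact τ.size_start _ _ _]
  · rw [allAt_flatMap_range fun i => length_cellGates τ.size_step _ _]
    refine forall₂_congr fun i _ => ?_
    rw [cellGates, allAt_flatMap_finRange fun j => by
      rw [BoolForm.length_gates]; exact τ.size_step _]

theorem addr_lt {n S t i : ℕ} (hi : i < S) (j : Fin τ.b) :
    τ.addr n S t i j < n + τ.rowSize S + t * τ.rowSize S := by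
  have hM : 0 < τ.M := τ.size_step j ▸ (τ.step j).size_pos
  have h₁ : (i + 1) * (τ.b * τ.M) ≤ τ.rowSize S := Nat.mul_le_mul_right _ hi
  have h₂ : (j.1 + 1) * τ.M ≤ τ.b * τ.M := Nat.mul_le_mul_right _ j.2
  rw [add_one_mul] at h₁ h₂
  rw [addr]
  omega

/-- Row `t + 1` reads only row `t`, and the initial row reads only inputs. The latter needs `0 < n`,
as even formulas that ignore the input bit refer to an input wire. -/
theorem acyclic_gates {x : List Bool} {n T : ℕ} (hn : 0 < n) : Acyclic n (τ.gates x n T) := by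
  refine allAt_gates.2 ⟨fun i _ j => ?_, fun t _ i hi j => ?_, ?_⟩
  · exact BoolForm.acyclic_gates _ fun _ => by omega
  · refine BoolForm.acyclic_gates _ fun v => ?_
    have : (![0, i - 1, i, min (i + 1) (T + 1 - 1)] : Fin 4 → ℕ) v.1 < T + 1 := by
      generalize v.1 = s
      fin_cases s <;> simp <;> omega
    have := addr_lt (n := n) (t := t) this v.2
    rw [neighbour]
    omega
  · refine BoolForm.acyclic_gates _ fun v => ?_
    cases v with
    | none => simp; omega
    | some j => exact addr_lt (Nat.succ_pos T) j

variable (τ) in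
/-- The circuit that maps `w` to itself if the final formula yields the first bit of `w`, and that
changes the first bit otherwise. -/
def circuit (x : List Bool) (n T : ℕ) : Circuit :=
  if hn : 0 < n then
    { width := n
      gates := τ.gates x n T
      outputs := τ.finalWire n T :: (List.range (n - 1)).map (· + 1)
      outputs_length := by simp; omega
      gates_wf := (acyclic_gates hn).get
      outputs_wf := by
        have := τ.final.size_pos
        have h : (τ.gates x n T).length =
            τ.rowSize (T + 1) + (T * τ.rowSize (T + 1) + τ.final.size) := by
          simp [gates, length_startGates, length_stepGates]
        simp only [List.mem_cons, List.mem_map, List.mem_range, forall_eq_or_imp, h, finalWire]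
        refine ⟨by omega, ?_⟩
        rintro _ ⟨i, hi, rfl⟩
        omega }
  else ⟨0, [], [], rfl, by simp, by simp⟩

/-- Replaces the case distinction on a proof of `0 < n` by a Boolean test, so that the calculus of
polynomial-time functions applies. -/
theorem encode_circuit (x : List Bool) (n T : ℕ) :
    (τ.circuit x n T).encode = cond (n == 0) [.sep] (encodeNat n ++
      ((τ.gates x n T).flatMap Gate.encode ++ (encodeNat (τ.finalWire n T) ++
        (List.range (n - 1)).flatMap fun i => encodeNat (i + 1)))) := by
  rcases n.eq_zero_or_pos with rfl | hn
  · rfl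
  · have : (n == 0) = false := beq_false_of_ne hn.ne'
    simp [circuit, hn, Circuit.encode, this, List.flatMap_map]

theorem poly_source {ε : Type} [Coded ε] {x : ε → List Bool} {n i : ε → ℕ} (hx : Poly x)
    (hn : Poly n) (hi : Poly i) : Poly (fun e => source (x e) (n e) (i e)) := by
  have h₁ : Poly (fun e => ((x e).map some ++ [none])[i e]?) :=
    .getElem? hi (.append (hx.map some) (.const _))
  have h₂ : Poly (fun e => decide (i e < (x e).length + 1 + n e)) :=
    .natDecLt hi (by fun_prop)
  exact .letter₂ (fun (o : Option (Option Bool)) c => o.elim (cond c (some none) none)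
    fun o => some (some o)) h₁ h₂

theorem poly_cellGates {ε V : Type} [Coded ε] (e : Fin τ.b → BoolForm V) {ρ : ε → V → ℕ}
    {base : ε → ℕ} (hρ : ∀ v, Poly (fun a => ρ a v)) (hb : Poly base) :
    PolyGates (fun a => τ.cellGates e (ρ a) (base a)) :=
  .flatMap_list _ fun j => .form (e j) hρ (by fun_prop)

theorem poly_rowSize {ε : Type} [Coded ε] {S : ε → ℕ} (hS : Poly S) :
    Poly (fun e => τ.rowSize (S e)) := by
  unfold rowSize
  fun_prop

theorem poly_addr {ε : Type} [Coded ε] {n S t i : ε → ℕ} (hn : Poly n) (hS : Poly S) (ht : Poly t)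
    (hi : Poly i) (j : Fin τ.b) : Poly (fun e => τ.addr (n e) (S e) (t e) (i e) j) := by
  have := poly_rowSize (τ := τ) hS
  unfold addr
  fun_prop

theorem poly_startGates {ε : Type} [Coded ε] {x : ε → List Bool} {n S : ε → ℕ} (hx : Poly x)
    (hn : Poly n) (hS : Poly S) : PolyGates (fun e => τ.startGates (x e) (n e) (S e)) := by
  refine .flatMap_range hS ?_
  have hx' : Poly (fun p : ε × ℕ => x p.1) := hx.comp Poly.fst
  have hn' : Poly (fun p : ε × ℕ => n p.1) := hn.comp Poly.fst
  -- For a fixed flag and source the formulas are fixed. The actual flag and source vary with the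
  -- cell but take finitely many values, so `Poly.cases` combines them.
  have h (c : Bool) (k : Source) : PolyGates (fun p : ε × ℕ => τ.cellGates (τ.start c k)
      (fun _ => min (p.2 - ((x p.1).length + 1)) (n p.1 - 1)) (n p.1 + p.2 * (τ.b * τ.M))) :=
    poly_cellGates _ (fun _ => .min (by fun_prop) (by fun_prop)) (by fun_prop)
  have h' (c : Bool) := Poly.cases (f := fun k (p : ε × ℕ) => (τ.cellGates (τ.start c k)
      (fun _ => min (p.2 - ((x p.1).length + 1)) (n p.1 - 1))
      (n p.1 + p.2 * (τ.b * τ.M))).flatMap Gate.encode)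
      (poly_source hx' hn' Poly.snd) (h c)
  exact Poly.cases (f := fun c (p : ε × ℕ) => (τ.cellGates (τ.start c (source (x p.1) (n p.1) p.2))
      (fun _ => min (p.2 - ((x p.1).length + 1)) (n p.1 - 1))
      (n p.1 + p.2 * (τ.b * τ.M))).flatMap Gate.encode) (Poly.isZero Poly.snd) h'

theorem poly_stepGates {ε : Type} [Coded ε] {n S T : ε → ℕ} (hn : Poly n) (hS : Poly S)
    (hT : Poly T) : PolyGates (fun e => τ.stepGates (n e) (S e) (T e)) := by
  refine .flatMap_range hT ?_
  refine .flatMap_range (G := fun (p : ε × ℕ) i => τ.cellGates τ.step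
    (τ.neighbour (n p.1) (S p.1) p.2 i) (n p.1 + τ.rowSize (S p.1) + p.2 * τ.rowSize (S p.1) +
      i * (τ.b * τ.M))) (hS.comp Poly.fst) ?_
  have hn' : Poly (fun p : (ε × ℕ) × ℕ => n p.1.1) := hn.comp (Poly.fst.comp Poly.fst)
  have hS' : Poly (fun p : (ε × ℕ) × ℕ => S p.1.1) := hS.comp (Poly.fst.comp Poly.fst)
  have ht : Poly (fun p : (ε × ℕ) × ℕ => p.1.2) := Poly.snd.comp Poly.fst
  have hr := poly_rowSize (τ := τ) hS'
  refine poly_cellGates _ (fun v => ?_) (by fun_prop)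
  obtain ⟨s, j⟩ := v
  refine poly_addr hn' hS' ht ?_ j
  fin_cases s
  · exact .const 0
  · exact Poly.pred Poly.snd
  · exact Poly.snd
  · exact .min (by fun_prop) (by fun_prop)

theorem poly_encode {ε : Type} [Coded ε] {x : ε → List Bool} {n T : ε → ℕ} (hx : Poly x)
    (hn : Poly n) (hT : Poly T) : Poly (fun e => (τ.circuit (x e) (n e) (T e)).encode) := by
  have hT' : Poly (fun e => T e + 1) := by fun_prop
  have hr := poly_rowSize (τ := τ) hT'
  have hg : PolyGates (fun e => τ.gates (x e) (n e) (T e)) := by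
    refine (poly_startGates hx hn hT').append ((poly_stepGates hn hT' hT).append
      (.form _ (fun v => ?_) (by fun_prop)))
    cases v with
    | none => exact .const 0
    | some j => exact poly_addr hn hT' hT (.const 0) j
  have hf : Poly (fun e => τ.finalWire (n e) (T e)) := by
    unfold finalWire
    fun_prop
  have ho : Poly (fun e => (List.range (n e - 1)).flatMap fun i => encodeNat (i + 1)) :=
    .flatMap_range (f := fun _ i => encodeNat (i + 1)) (by fun_prop)
      (Poly.encodeNat (ε := ε × ℕ) (by fun_prop))
  simp only [encode_circuit]
  exact .cond (Poly.isZero hn) (.const _) (hn.encodeNat.append (.append hg (.append hf.encodeNat ho)))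

/-- The formulas of `τ` describe an automaton whose states are written by `enc` as bit strings. -/
structure Simulates {X : Type} (τ : Simulator) (enc : X → Fin τ.b → Bool)
    (rule : X → X → X → X → X) (init : Bool → Option (Option Bool) → X) (acc : X → Bool) :
    Prop where
  start : ∀ c k j a, (τ.start c k j).eval a = enc (init c (k.letter (a ()))) j
  step : ∀ j (s : Fin 4 → X),
    (τ.step j).eval (fun v => enc (s v.1) v.2) = enc (rule (s 0) (s 1) (s 2) (s 3)) j
  final : ∀ u s, τ.final.eval (Option.elim · u (enc s)) = cond (acc s) u !u

section Simulates

variable {X : Type} {rule : X → X → X → X → X} {init : Bool → Option (Option Bool) → X}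
  {acc : X → Bool}

theorem exists_simulates [Finite X] : ∃ (τ : Simulator) (enc : X → Fin τ.b → Bool),
    τ.Simulates enc rule init acc := by
  classical
  have : Nonempty X := ⟨init false none⟩
  obtain ⟨b, ⟨φ⟩⟩ := Finite.exists_equiv_fin X
  have : Nonempty (Fin b) := this.map φ
  -- States are coded by unit vectors, and formulas decode with `invFun`. Their values on bit
  -- vectors that code no state are irrelevant.
  let enc (s : X) (j : Fin b) : Bool := decide (φ s = j)
  have henc : Injective enc := fun s s' h => by
    have := congrFun h (φ s')
    simpa [enc] using this
  have hdec := leftInverse_invFun henc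
  obtain ⟨m₁, h₁⟩ := BoolForm.exists_family_size_eq (V := Fin 4 × Fin b) fun j a =>
    let s (i : Fin 4) : X := invFun enc fun j => a (i, j)
    enc (rule (s 0) (s 1) (s 2) (s 3)) j
  obtain ⟨m₂, h₂⟩ := BoolForm.exists_family_size_eq (V := Unit)
    fun (i : Bool × Source × Fin b) a => enc (init i.1 (i.2.1.letter (a ()))) i.2.2
  obtain ⟨e₁, h₁⟩ := h₁ (max m₁ m₂) (le_max_left _ _)
  obtain ⟨e₂, h₂⟩ := h₂ (max m₁ m₂) (le_max_right _ _)
  obtain ⟨e₃, h₃⟩ := BoolForm.exists_eval_eq (V := Option (Fin b)) fun a =>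
    cond (acc (invFun enc fun j => a (some j))) (a none) !a none
  refine ⟨⟨b, max m₁ m₂, e₁, fun c k j => e₂ (c, k, j), e₃, fun j => (h₁ j).1,
    fun c k j => (h₂ (c, k, j)).1⟩, enc, fun c k j => (h₂ (c, k, j)).2, fun j s => ?_,
    fun u s => ?_⟩
  · rw [(h₁ j).2]
    have hs (i : Fin 4) : (invFun enc fun j => enc (s i) j) = s i := hdec (s i)
    simp only [hs]
  · rw [h₃]
    exact congrArg (fun s => cond (acc s) u !u) (hdec s)

variable {enc : X → Fin τ.b → Bool} {x y : List Bool} {T : ℕ} {val : ℕ → Bool}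

/-- Only cells `0` to `T` are simulated, and the last one lacks its right neighbour. The resulting
error travels left by one cell per step, so the values are correct in the triangle `i + t ≤ T`,
which includes cell 0 at time `T`. -/
theorem Simulates.val_addr (h : τ.Simulates enc rule init acc) (hy : 0 < y.length)
    (hval : ∀ i < y.length, val i = y.getD i false)
    (hc : Computes val y.length (τ.gates x y.length T)) {t i : ℕ} (hit : i + t < T + 1)
    (j : Fin τ.b) : val (τ.addr y.length (T + 1) t i j) =
      enc (automaton rule (fun i => init (i == 0) (encodePair (x, y))[i]?) t i) j := by
  obtain ⟨h₁, h₂, -⟩ := allAt_gates.1 hc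
  induction t generalizing i j with
  | zero =>
    have := BoolForm.value_of_computes _ (h₁ i hit j)
    rw [τ.size_start, h.start, hval (min (i - (x.length + 1)) (y.length - 1)) (by omega),
      letter_source] at this
    simpa [addr, automaton] using this
  | succ t ih =>
    have := BoolForm.value_of_computes _ (h₂ t (by omega) i (by omega) j)
    rw [τ.size_step] at this
    have he : (fun v => val (τ.neighbour y.length (T + 1) t i v)) = fun v => enc
        ((![0, i - 1, i, i + 1] : Fin 4 → ℕ) v.1 |> automaton rule
          (fun i => init (i == 0) (encodePair (x, y))[i]?) t) v.2 := by
      funext ⟨s, k⟩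
      have hs : (![0, i - 1, i, min (i + 1) (T + 1 - 1)] : Fin 4 → ℕ) s =
          (![0, i - 1, i, i + 1] : Fin 4 → ℕ) s := by
        -- Inside the triangle the right neighbour exists, so the clamping has no effect.
        rw [min_eq_left (by omega)]
      rw [neighbour, hs]
      refine ih ?_ k
      fin_cases s <;> simp <;> omega
    rw [he, h.step _ fun s => automaton rule (fun i => init (i == 0) (encodePair (x, y))[i]?) t
      ((![0, i - 1, i, i + 1] : Fin 4 → ℕ) s)] at this
    rw [addr, add_one_mul, add_comm (t * _), ← add_assoc y.length]
    exact this

/-- All outputs but the first copy the input, so only the first bit is in question. It is kept on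
acceptance and negated on rejection, and a bit never equals its negation. -/
theorem Simulates.outputs_eq_iff (h : τ.Simulates enc rule init acc) (hy : 0 < y.length) :
    (τ.circuit x y.length T).outputs.map
      (((τ.circuit x y.length T).wires y).getD · false) = y ↔
      acc (automaton rule (fun i => init (i == 0) (encodePair (x, y))[i]?) T 0) = true := by
  have hg := acyclic_gates (τ := τ) (x := x) (T := T) hy
  obtain ⟨⟨u, hu⟩, hc⟩ := wires_computes _ y hg
  simp only [circuit, hy, dif_pos, Circuit.wires]
  generalize (τ.gates x y.length T).foldl (fun v g => v ++ [g.eval v]) y = W at hu hc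
  have hval (i : ℕ) (hi : i < y.length) : W.getD i false = y.getD i false := by
    rw [← hu, List.getD_append _ _ _ _ hi]
  have hf := BoolForm.value_of_computes _ (allAt_gates.1 hc).2.2
  have he : (fun v => W.getD (Option.elim v 0 (τ.addr y.length (T + 1) T 0)) false) =
      (Option.elim · (y.getD 0 false) (enc (automaton rule
        (fun i => init (i == 0) (encodePair (x, y))[i]?) T 0))) := by
    funext v
    cases v with
    | none => exact hval 0 hy
    | some j => exact h.val_addr hy hval hc (by omega) j
  rw [he, h.final] at hf
  have hy' : y = y.getD 0 false :: (List.range (y.length - 1)).map fun i => y.getD (i + 1) false := by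
    refine List.ext_getElem (by simp; omega) fun i hi _ => ?_
    cases i <;> simp [hi]
  have hr : (List.range (y.length - 1)).map (fun i => W.getD (i + 1) false) =
      (List.range (y.length - 1)).map fun i => y.getD (i + 1) false :=
    List.map_congr_left fun i hi => hval _ (by rw [List.mem_range] at hi; omega)
  rw [List.map_cons, List.map_map]
  conv_lhs => rhs; rw [hy']
  rw [List.cons.injEq, finalWire, hf]
  simp only [comp_def, hr, and_true]
  cases acc _ <;> simp

end Simulates

end Simulator

/-- The width is the computed length `l x`, and the number of simulated steps is the time bound for
a pair whose encoding has length `x.length + 1 + l x`. The fixed points are then exactly the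
solutions. -/
theorem mem_FPNCCircExact {R : Set (List Bool × List Bool)} (hR : R ∈ TFUP)
    (hl : PolyTimeSolutionLength R) : R ∈ FPNCCircExact := by
  classical
  obtain ⟨hdec, -, huniq⟩ := hR
  obtain ⟨l, hl, hlen⟩ := hl
  rw [polyTime_encodeUnary_iff] at hl
  obtain ⟨X, _, rule, init, acc, p, hp⟩ := PolyTime.exists_automaton hdec
  obtain ⟨τ, enc, hτ⟩ := Simulator.exists_simulates (rule := rule) (init := init) (acc := acc)
  let C (x : List Bool) := τ.circuit x (l x) (p.eval (x.length + 1 + l x))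
  have hwidth (x : List Bool) : (C x).width = l x := by
    rcases (l x).eq_zero_or_pos with h | h <;> simp [C, Simulator.circuit, h]
  have hC (x w : List Bool) : (x, w) ∈ R ↔
      ∃ v : List.Vector Bool (C x).width, IsFixedPt (C x).fn v ∧ v.toList = w := by
    rw [exists_isFixedPt_iff]
    by_cases hw : w.length = l x
    · rcases w.length.eq_zero_or_pos with h₀ | h₀
      -- Without wires nothing is tested and the empty string is the only fixed point. This is
      -- right, since a solution exists and has length 0.
      · obtain rfl := List.length_eq_zero_iff.1 h₀
        obtain ⟨y, hy, -⟩ := huniq x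
        have : y = [] := List.length_eq_zero_iff.1 ((hlen x y hy).trans hw.symm)
        subst this
        simp [hy, C, ← hw, Simulator.circuit]
      · have := hp (x, w) (p.eval (x.length + 1 + w.length))
          (le_of_eq (by simp [encodePair, add_assoc, add_comm 1]))
        simp only [C, ← hw]
        rw [hτ.outputs_eq_iff h₀, this, decide_eq_true_iff]
    · refine iff_of_false (fun h => hw (hlen x w h)) fun h => hw ?_
      rw [← hwidth, ← (C x).outputs_length, ← congrArg List.length h, List.length_map]
  refine ⟨⟨C, ?_, fun x => ?_⟩, hC⟩
  · have : Poly fun x => (C x).encode :=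
      Simulator.poly_encode Poly.id hl (.eval p (by fun_prop))
    exact this.congr fun _ => rfl
  · obtain ⟨y, hy, hy'⟩ := huniq x
    obtain ⟨v, hv, hvy⟩ := (hC x y).1 hy
    refine ⟨v, hv, fun v' hv' => ?_⟩
    have := hy' _ ((hC x _).2 ⟨v', hv', rfl⟩)
    exact List.Vector.toList_injective (this.trans hvy.symm)

end NCCirc

/-! ### From circuits to relations, and padding -/

namespace NCCirc

open Function

open Classical in
theorem mem_TFUP_of_mem_FPNCCircExact {R : Set (List Bool × List Bool)} (h : R ∈ FPNCCircExact) :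
    R ∈ TFUP ∧ PolyTimeSolutionLength R := by
  obtain ⟨𝒜, h𝒜⟩ := h
  have hR (x w) : (x, w) ∈ R ↔ checkFixed (𝒜.circuit x).encode w = true := by
    rw [checkFixed_encode, decide_eq_true_iff, ← exists_isFixedPt_iff]
    exact h𝒜 x w
  have hlen (x w) (h : (x, w) ∈ R) : w.length = (𝒜.circuit x).width := by
    obtain ⟨v, -, rfl⟩ := (h𝒜 x w).1 h
    exact v.toList_length
  refine ⟨⟨?_, ?_, fun x => ?_⟩, _, polyTime_encodeUnary_iff.2 𝒜.poly_width, hlen⟩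
  · rw [polynomiallyDecidable_iff]
    have hc := 𝒜.poly_encode
    have : Poly (fun p : List Bool × List Bool => checkFixed (𝒜.circuit p.1).encode p.2) :=
      poly_checkFixed.comp (f := fun p : List Bool × List Bool => ((𝒜.circuit p.1).encode, p.2))
        ((hc.comp Poly.fst).prodMk Poly.snd)
    refine this.congr fun p => congrArg _ ?_
    rw [Bool.eq_iff_iff, decide_eq_true_iff]
    exact hR _ _
  · obtain ⟨q, hq⟩ := 𝒜.poly_width.length_le
    exact ⟨q, fun x y h => (hlen x y h).trans_le (by simpa using hq x)⟩
  · obtain ⟨v, hv, huniq⟩ := 𝒜.consistent x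
    refine ⟨v.toList, (h𝒜 _ _).2 ⟨v, hv, rfl⟩, fun y hy => ?_⟩
    obtain ⟨v', hv', rfl⟩ := (h𝒜 _ _).1 hy
    rw [huniq v' hv']

theorem unpad_append_replicate (y : List Bool) (n : ℕ) :
    unpad (y ++ true :: List.replicate n false) = y := by
  have : (y ++ true :: List.replicate n false).rdropWhile (fun b => !b) = y ++ [true] := by
    rw [List.rdropWhile]
    simp
  rw [unpad, this]
  simp

theorem unpad_replicate (n : ℕ) : unpad (List.replicate n false) = [] := by
  simp [unpad, List.rdropWhile]

/-- A string is its unpadded form with padding, or consists of zeros. -/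
theorem eq_padded_or_eq_replicate (w : List Bool) :
    (∃ n, w = unpad w ++ true :: List.replicate n false) ∨
      w = List.replicate w.length false := by
  induction w using List.reverseRecOn with
  | nil => exact .inr rfl
  | append_singleton w b ih =>
    cases b with
    | true => exact .inl ⟨0, by simpa using (unpad_append_replicate w 0).symm⟩
    | false =>
      rcases ih with ⟨n, hn⟩ | hn
      · refine .inl ⟨n + 1, ?_⟩
        have h : w ++ [false] = unpad w ++ true :: List.replicate (n + 1) false := by
          rw [List.replicate_succ']
          nth_rw 1 [hn]
          simp
        rw [h, unpad_append_replicate]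
      · right
        nth_rw 1 [hn]
        simp [List.replicate_succ']

theorem poly_unpad : Poly unpad := by
  have h (l : List Bool) : mealy (fun q b => (q || b, if q || b then some b else none))
      (fun _ => none) false l = l.dropWhile (fun b => !b) := by
    have h' (l : List Bool) : mealy (fun q b => (q || b, if q || b then some b else none))
        (fun _ => none) true l = l := by
      induction l with
      | nil => rfl
      | cons b l ih => simpa [mealy] using ih
    induction l with
    | nil => rfl
    | cons b l ih =>
      cases b
      · simpa [mealy] using ih
      · simpa [mealy] using h' l
  have := (Poly.mealyList (fun q b => (q || b, if q || b then some b else none)) (fun _ => none)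
    false (Poly.id.reverse)).tail.reverse
  refine this.congr fun w => ?_
  rw [h]
  simp [unpad, List.rdropWhile, List.dropLast_reverse]

open Classical in
-- The unpadded case applies to the relation `R'` of the fixed points themselves. To decide whether
-- `y` is a solution, guessing the fixed point is unnecessary: its length `l x` is known, so it can
-- only be `y10…0`, or all zeros if `y` is empty.
theorem mem_TFUP_of_mem_FPNCCirc {R : Set (List Bool × List Bool)} (h : R ∈ FPNCCirc) :
    R ∈ TFUP := by
  obtain ⟨𝒜, h𝒜⟩ := h
  let R' : Set (List Bool × List Bool) :=
    {p | ∃ w : List.Vector Bool (𝒜.circuit p.1).width, IsFixedPt (𝒜.circuit p.1).fn w ∧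
      w.toList = p.2}
  obtain ⟨⟨hdec, ⟨q, hq⟩, huniq⟩, l, hl, hlen⟩ :=
    mem_TFUP_of_mem_FPNCCircExact (R := R') ⟨𝒜, fun _ _ => Iff.rfl⟩
  have hR (x y) : (x, y) ∈ R ↔ ∃ w, (x, w) ∈ R' ∧ unpad w = y := by
    rw [h𝒜]
    constructor
    · rintro ⟨w, hw, h⟩
      exact ⟨_, ⟨w, hw, rfl⟩, h⟩
    · rintro ⟨w', ⟨w, hw, hw'⟩, h⟩
      exact ⟨w, hw, (congrArg unpad hw').trans h⟩
  clear_value R'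
  rw [polynomiallyDecidable_iff] at hdec
  rw [polyTime_encodeUnary_iff] at hl
  refine ⟨polynomiallyDecidable_iff.2 ?_, ⟨q, fun x y hxy => ?_⟩, fun x => ?_⟩
  · let pad : List Bool × List Bool → List Bool := fun p =>
      p.2 ++ true :: List.replicate (l p.1 - p.2.length - 1) false
    have h₁ : Poly (fun p : List Bool × List Bool => decide (p.2.length < l p.1)) :=
      Poly.natDecLt (by fun_prop) (by fun_prop)
    have h₂ : Poly (fun p : List Bool × List Bool => decide ((p.1, pad p) ∈ R')) :=
      hdec.comp (f := fun p : List Bool × List Bool => (p.1, pad p)) (by fun_prop)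
    have h₃ : Poly (fun p : List Bool × List Bool =>
        decide ((p.1, List.replicate (l p.1) false) ∈ R')) :=
      hdec.comp (f := fun p : List Bool × List Bool => (p.1, List.replicate (l p.1) false))
        (by fun_prop)
    have := (h₁.and h₂).or (Poly.snd.isEmpty.and h₃)
    refine this.congr fun ⟨x, y⟩ => congrArg _ ?_
    rw [Bool.eq_iff_iff]
    simp only [decide_eq_true_iff, Bool.or_eq_true, Bool.and_eq_true, List.isEmpty_iff, hR]
    constructor
    · rintro ⟨w, hw, rfl⟩
      have hlw := hlen _ _ hw
      rcases eq_padded_or_eq_replicate w with ⟨n, hn⟩ | hn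
      · left
        have hw' := congrArg List.length hn
        simp only [List.length_append, List.length_cons, List.length_replicate] at hw'
        refine ⟨by omega, ?_⟩
        have : l x - (unpad w).length - 1 = n := by omega
        simpa only [pad, this, ← hn] using hw
      · right
        refine ⟨by rw [hn, unpad_replicate], ?_⟩
        rw [← hlw, ← hn]
        exact hw
    · rintro (⟨-, h⟩ | ⟨rfl, h⟩)
      · exact ⟨_, h, unpad_append_replicate _ _⟩
      · exact ⟨_, h, unpad_replicate _⟩
  · obtain ⟨w, hw, rfl⟩ := (hR x y).1 hxy
    refine le_trans ?_ (hq _ _ hw)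
    rcases eq_padded_or_eq_replicate w with ⟨n, hn⟩ | hn
    · have hw' := congrArg List.length hn
      simp only [List.length_append, List.length_cons, List.length_replicate] at hw'
      omega
    · rw [hn, unpad_replicate]; simp
  · obtain ⟨w, hw, hu⟩ := huniq x
    refine ⟨unpad w, (hR _ _).2 ⟨w, hw, rfl⟩, fun y hy => ?_⟩
    obtain ⟨w', hw', rfl⟩ := (hR _ _).1 hy
    rw [hu w' hw']

open Classical in
-- The padded relation `R'` has solutions of computable length, whence an algorithm without padding
-- for `R'`; unpadding its fixed points gives `R`.
theorem mem_FPNCCirc_of_mem_TFUP {R : Set (List Bool × List Bool)} (h : R ∈ TFUP) :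
    R ∈ FPNCCirc := by
  obtain ⟨hdec, ⟨q, hq⟩, huniq⟩ := h
  rw [polynomiallyDecidable_iff] at hdec
  -- The extra wire makes room for the mark 1 after a solution of maximal length.
  let l : List Bool → ℕ := fun x => q.eval x.length + 1
  have hl : Poly l := (Poly.eval q (by fun_prop)).add (by fun_prop)
  -- A bit 1 is required because the string of zeros also unpads to the empty string; it would be a
  -- second padded form of an empty solution.
  let R' : Set (List Bool × List Bool) :=
    {p | p.2.length = l p.1 ∧ true ∈ p.2 ∧ (p.1, unpad p.2) ∈ R}
  have hpad {x w} (h : (x, w) ∈ R') :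
      w = unpad w ++ true :: List.replicate (l x - (unpad w).length - 1) false := by
    rcases eq_padded_or_eq_replicate w with ⟨n, hn⟩ | hn
    · have hw' := congrArg List.length hn
      simp only [List.length_append, List.length_cons, List.length_replicate] at hw'
      have := h.1
      have : l x - (unpad w).length - 1 = n := by
        simp only at this
        omega
      rw [this]
      exact hn
    · have := h.2.1
      simp only at this
      rw [hn] at this
      simp at this
  have hmem {x y} (h : (x, y) ∈ R) :
      (x, y ++ true :: List.replicate (l x - y.length - 1) false) ∈ R' := by
    refine ⟨?_, by simp, by simpa [unpad_append_replicate] using h⟩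
    have := hq x y h
    simp only [List.length_append, List.length_cons, List.length_replicate, l]
    omega
  have hR' : R' ∈ TFUP := by
    refine ⟨polynomiallyDecidable_iff.2 ?_, ⟨q + 1, fun x y hxy => ?_⟩, fun x => ?_⟩
    · have h₁ : Poly (fun p : List Bool × List Bool => decide (p.2.length = l p.1)) :=
        Poly.natDecEq (by fun_prop) (by fun_prop)
      have h₂ : Poly (fun p : List Bool × List Bool =>
          !(p.2.filterMap fun b => if b then some b else none).isEmpty) := by fun_prop
      have hu := poly_unpad
      have h₃ : Poly (fun p : List Bool × List Bool => decide ((p.1, unpad p.2) ∈ R)) :=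
        hdec.comp (f := fun p : List Bool × List Bool => (p.1, unpad p.2)) (by fun_prop)
      refine ((h₁.and h₂).and h₃).congr fun ⟨x, w⟩ => congrArg _ ?_
      rw [Bool.eq_iff_iff]
      simp [R', and_assoc]
    · simpa [l] using hxy.1.le
    · obtain ⟨y, hy, hu⟩ := huniq x
      refine ⟨_, hmem hy, fun w hw => ?_⟩
      rw [hpad hw, hu _ hw.2.2]
  obtain ⟨𝒜, h𝒜⟩ := mem_FPNCCircExact hR'
    ⟨l, polyTime_encodeUnary_iff.2 hl, fun x y h => h.1⟩
  refine ⟨𝒜, fun x y => ?_⟩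
  constructor
  · intro h
    obtain ⟨w, hw, hw'⟩ := (h𝒜 _ _).1 (hmem h)
    exact ⟨w, hw, by rw [hw', unpad_append_replicate]⟩
  · rintro ⟨w, hw, rfl⟩
    exact ((h𝒜 x w.toList).2 ⟨w, hw, rfl⟩).2.2

end NCCirc

theorem theorem3 :
    NCCirc.FPNCCirc = NCCirc.TFUP ∧
    NCCirc.FPNCCircExact = {R | R ∈ NCCirc.TFUP ∧ NCCirc.PolyTimeSolutionLength R} := by
  refine ⟨Set.Subset.antisymm (fun _ => NCCirc.mem_TFUP_of_mem_FPNCCirc)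
    fun _ => NCCirc.mem_FPNCCirc_of_mem_TFUP,
    Set.Subset.antisymm (fun _ => NCCirc.mem_TFUP_of_mem_FPNCCircExact)
      fun _ h => NCCirc.mem_FPNCCircExact h.1 h.2⟩
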